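/- \textbf{Conventions.} A \emph{metric simplicial complex} is a (nonempty) connected, locally finite simplicial complex $X$, identified with its geometric realization, whose $1$-skeleton carries the path metric with edges of length one. It has \emph{bounded geometry} if the number of simplices in its links is uniformly bounded. The diameter of a subcomplex is the diameter of its vertex set. For a subcomplex $K\subset X$ put $N_0(K)=K$ and let $N_{r+1}(K)$ be the closed star of $N_r(K)$, i.e. the union of all closed simplices of $X$ meeting $N_r(K)$. Simplicial chains $C_*(X)$ and compactly supported simplicial cochains $C_c^*(X)$ have integer coefficients and are extended by zero to all degrees in $\mathbb Z$. The support of a set of (co)chains is the smallest subcomplex containing all simplices that occur in them. $X$ is \emph{uniformly acyclic} if for every $R_1$ there is an $R_2$ such that for every subcomplex $K\subset X$ of diameter $\le R_1$ the inclusion $K\to N_{R_2}(K)$ induces zero on reduced homology in all degrees $\ge 0$. A homomorphism $h$ between the groups $C_*(X)$, $C_c^*(X)$ has \emph{displacement} $\le D$ if for each simplex $\sigma$ the support of the image under $h$ of the (co)chains carried by $\sigma$ lies in $N_D(\sigma)$. A chain homotopy $\Phi$ between $f_0$ and $f_1$ is \emph{$L$-Lipschitz} if for each simplex $\sigma$ the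 union of the supports of the images under $f_0$, $f_1$ and $\Phi$ of the (co)chains carried by $\sigma$ has diameter $\le L$. A \emph{coarse $PD(n)$ space} is a bounded geometry, uniformly acyclic metric simplicial complex $X$ for which there are a constant $D_0$ and chain maps $$C_*(X)\xrightarrow{\ \bar P\ }C_c^{n-*}(X)\xrightarrow{\ P\ }C_*(X)$$ of displacement $\le D_0$ such that $P\circ\bar P$ and $\bar P\circ P$ are chain homotopic to the identity by $D_0$-Lipschitz chain homotopies. A simplicial map $g:X'\to X$ is \emph{uniformly proper} if it is coarse Lipschitz and there is a function $\phi:[0,\infty)\to[0,\infty)$ with $\phi(t)\to\infty$ as $t\to\infty$ and $d(g(x),g(y))\ge\phi(d(x,y))$ for all $x,y$. Let $K\subset X$ be a subcomplex and $R\ge 0$ an integer. A connected component of $X-N_R(K)$, or of its closure in $X$, is \emph{deep} if it is contained in no $N_r(K)$. A deep component $C$ of $X-N_R(K)$ is \emph{stable} if for each $R'\ge R$ it meets exactly one deep component of $X-N_{R'}(K)$. $K$ \emph{coarsely separates} $X$ if for some $R$ the space $X-N_R(K)$ has at least two deep components; it coarsely separates $X$ \emph{into exactly $m$ components} if for some $R$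 the space $X-N_R(K)$ has exactly $m$ deep components and all of them are stable. \textbf{Theorem (Coarse Jordan separation for maps).} Let $X$ be a coarse $PD(n)$ space, $X'$ a coarse $PD(n-1)$ space, and $g:X'\to X$ a uniformly proper simplicial map. Then: 1. $g(X')$ coarsely separates $X$ into exactly two components. 2. For every $R$ there is an $S$ such that each point of $N_R(g(X'))$ lies within distance $S$ of each of the deep components of $Y_R:=\overline{X-N_R(g(X'))}$. (The distance between two points is measured in the $1$-skeleton, between suitable vertices of the simplices containing these points in their interiors.) 3. If $Z\subset X'$ is a subcomplex and $X'\not\subset N_R(Z)$ for every $R$, then $g(Z)$ does not coarsely separate $X$. -/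

import Mathlib

open scoped NNReal

/-- The 1-skeleton, as a graph on the vertices. -/
def AbstractSimplicialComplex.oneSkeleton {V : Type*} (X : AbstractSimplicialComplex V) :
    SimpleGraph V where
  Adj v w := v ≠ w ∧ ∃ σ ∈ X.faces, v ∈ σ ∧ w ∈ σ
  symm := ⟨fun _ _ h => ⟨h.1.symm, h.2.imp fun _ hs => ⟨hs.1, hs.2.2, hs.2.1⟩⟩⟩
  loopless := ⟨fun _ h => h.1 rfl⟩

/-- A metric simplicial complex: a connected, locally finite simplicial complex with vertex set
`V`.  (The metric on its 1-skeleton is `MetricSimplicialComplex.dist` below.)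
Subcomplexes are elements `K : PreAbstractSimplicialComplex V` with
`K ≤ X.toPreAbstractSimplicialComplex`; the empty subcomplex is allowed. -/
structure MetricSimplicialComplex (V : Type*) extends AbstractSimplicialComplex V where
  /-- each vertex lies in only finitely many simplices -/
  locallyFinite : ∀ v : V, {σ ∈ faces | v ∈ σ}.Finite
  /-- there is a vertex, and any two vertices are joined by an edge path -/
  connected : toAbstractSimplicialComplex.oneSkeleton.Connected

/-- The geometric realization `|K|` in barycentric coordinates: functions `x : V → ℝ` that are
nonnegative, have sum one, and whose support is a simplex of `K`.  It carries the topology of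
pointwise convergence (the subspace topology from `V → ℝ`), which for a locally finite complex is
the usual topology of the realization. -/
def PreAbstractSimplicialComplex.realization {V : Type*} (K : PreAbstractSimplicialComplex V) :
    Set (V → ℝ) :=
  {x | (∀ v, 0 ≤ x v) ∧ ∃ σ ∈ K.faces, (∀ v, v ∈ σ ↔ x v ≠ 0) ∧ ∑ v ∈ σ, x v = 1}

namespace MetricSimplicialComplex

variable {V V' : Type*}

/-! ### Metric notions -/

/-- The distance between two vertices in the path metric of the 1-skeleton with edges of length
one. -/
noncomputable def dist (X : MetricSimplicialComplex V) (v w : V) : ℕ := X.oneSkeleton.dist v w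

/-- A set of vertices has diameter at most `r`. -/
def DiamLE (X : MetricSimplicialComplex V) (A : Set V) (r : ℕ) : Prop :=
  ∀ v ∈ A, ∀ w ∈ A, X.dist v w ≤ r

/-- The closed star of a subcomplex `K`: all faces of simplices that meet `K`. -/
def closedStar (X : MetricSimplicialComplex V) (K : PreAbstractSimplicialComplex V) :
    PreAbstractSimplicialComplex V where
  faces := {σ | σ.Nonempty ∧ ∃ τ ∈ X.faces, σ ⊆ τ ∧ ∃ v ∈ τ, {v} ∈ K.faces}
  isRelLowerSet_faces := fun _ ⟨hne, τ, hτ, hστ, hv⟩ =>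
    ⟨hne, fun _ hρ hρne => ⟨hρne, τ, hτ, hρ.trans hστ, hv⟩⟩

/-- The combinatorial `r`-tubular neighbourhood `N_r(K)`: the `r`-fold iterated closed star, with
`N_0(K) = K`. -/
def nbhd (X : MetricSimplicialComplex V) (r : ℕ) (K : PreAbstractSimplicialComplex V) :
    PreAbstractSimplicialComplex V :=
  X.closedStar^[r] K

/-- The link of a simplex `σ`. -/
def link [DecidableEq V] (X : MetricSimplicialComplex V) (σ : Finset V) : Set (Finset V) :=
  {τ | τ.Nonempty ∧ Disjoint σ τ ∧ σ ∪ τ ∈ X.faces}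

/-- Bounded geometry: all links have a uniformly bounded number of simplices. -/
def BoundedGeometry [DecidableEq V] (X : MetricSimplicialComplex V) : Prop :=
  ∃ N : ℕ, ∀ σ ∈ X.faces, (X.link σ).encard ≤ N

/-- `g` is a simplicial map from `X'` to `X` (it may collapse simplices). -/
def IsSimplicialMap [DecidableEq V] (X' : MetricSimplicialComplex V')
    (X : MetricSimplicialComplex V) (g : V' → V) : Prop :=
  ∀ σ ∈ X'.faces, σ.image g ∈ X.faces

/-- `g` is uniformly proper: it is coarse Lipschitz, and distances are bounded below through a
proper distortion function.  (Each point of the 1-skeleton lies within distance `1/2` of a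
vertex, so for simplicial maps it makes no difference whether this is asked of vertices or of
all points of the 1-skeleton.) -/
def IsUniformlyProper (X' : MetricSimplicialComplex V') (X : MetricSimplicialComplex V)
    (g : V' → V) : Prop :=
  (∃ L A : ℝ, ∀ v w, (X.dist (g v) (g w) : ℝ) ≤ L * X'.dist v w + A) ∧
  ∃ φ : ℝ≥0 → ℝ≥0, Filter.Tendsto φ Filter.atTop Filter.atTop ∧
    ∀ v w, φ (X'.dist v w) ≤ X.dist (g v) (g w)

/-! ### Simplicial chains and compactly supported cochains -/

/-- The total group `⨁ₖ Cₖ(X)` of simplicial chains with integer coefficients: a `k`-chain is a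
combination of simplices with `k + 1` vertices, each oriented by the order of its vertices. -/
abbrev Chains (X : MetricSimplicialComplex V) : Type _ := X.faces →₀ ℤ

/-- The total group `⨁ₖ C_cᵏ(X)` of compactly (i.e. finitely) supported simplicial cochains; a
simplex stands for the cochain dual to it. -/
abbrev Cochains (X : MetricSimplicialComplex V) : Type _ := X.faces →₀ ℤ

/-- The dimension of a simplex. -/
def dim {X : MetricSimplicialComplex V} (σ : X.faces) : ℤ := (σ.1.card : ℤ) - 1

/-- The incidence number `[τ : σ]`: it is `(-1)ⁱ` if `σ` arises from `τ = {v₀ < ⋯ < vₖ}` by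
deleting `vᵢ`, and zero otherwise. -/
def incidence [LinearOrder V] (τ σ : Finset V) : ℤ :=
  ∑ v ∈ τ, if τ.erase v = σ then (-1) ^ (τ.filter (· < v)).card else 0

theorem subset_of_incidence_ne_zero [LinearOrder V] {τ σ : Finset V} (h : incidence τ σ ≠ 0) :
    σ ⊆ τ := by
  obtain ⟨v, -, hv⟩ := Finset.exists_ne_zero_of_sum_ne_zero h
  by_cases hvs : τ.erase v = σ
  · exact hvs ▸ Finset.erase_subset v τ
  · simp [hvs] at hv

/-- The boundary of a simplex. -/
noncomputable def boundarySimplex [LinearOrder V] (X : MetricSimplicialComplex V) (τ : X.faces) :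
    X.Chains :=
  Finsupp.ofSupportFinite (fun σ : X.faces => incidence τ.1 σ.1) <| by
    refine Set.Finite.of_injOn (f := Subtype.val) (t := (τ.1.powerset : Set (Finset V))) ?_
      Subtype.val_injective.injOn (Finset.finite_toSet _)
    intro σ hσ
    simpa using subset_of_incidence_ne_zero hσ

/-- The coboundary of the cochain dual to a simplex. -/
noncomputable def coboundarySimplex [LinearOrder V] (X : MetricSimplicialComplex V)
    (σ : X.faces) : X.Cochains :=
  Finsupp.ofSupportFinite (fun τ : X.faces => incidence τ.1 σ.1) <| by
    obtain ⟨v, hv⟩ := (X.isRelLowerSet_faces σ.2).1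
    refine Set.Finite.of_injOn (f := Subtype.val) (t := {τ ∈ X.faces | v ∈ τ}) ?_
      Subtype.val_injective.injOn (X.locallyFinite v)
    intro τ hτ
    exact ⟨τ.2, subset_of_incidence_ne_zero hτ hv⟩

/-- The boundary operator `∂` of `C_*(X)`. -/
noncomputable def boundary [LinearOrder V] (X : MetricSimplicialComplex V) :
    X.Chains →ₗ[ℤ] X.Chains :=
  Finsupp.linearCombination ℤ X.boundarySimplex

/-- The coboundary operator `δ` of `C_c^*(X)`. -/
noncomputable def coboundary [LinearOrder V] (X : MetricSimplicialComplex V) :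
    X.Cochains →ₗ[ℤ] X.Cochains :=
  Finsupp.linearCombination ℤ X.coboundarySimplex

/-- The augmentation: the sum of the coefficients of the vertices. -/
noncomputable def augmentation (X : MetricSimplicialComplex V) : X.Chains →ₗ[ℤ] ℤ :=
  Finsupp.linearCombination ℤ (fun σ : X.faces => if σ.1.card = 1 then (1 : ℤ) else 0)

/-- The chain `c` lies in `C_*(K)`. -/
def SupportedIn (X : MetricSimplicialComplex V) (c : X.Chains)
    (K : PreAbstractSimplicialComplex V) : Prop :=
  ∀ σ ∈ c.support, σ.1 ∈ K.faces

/-- Uniform acyclicity: for every `R₁` there is an `R₂` such that for each subcomplex `K` of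
diameter at most `R₁` the inclusion `K → N_{R₂}(K)` induces zero on reduced homology (in all
degrees `≥ 0` simultaneously, by working in the total chain group). -/
def UniformlyAcyclic [LinearOrder V] (X : MetricSimplicialComplex V) : Prop :=
  ∀ R₁ : ℕ, ∃ R₂ : ℕ, ∀ K : PreAbstractSimplicialComplex V,
    K ≤ X.toPreAbstractSimplicialComplex → X.DiamLE {v | {v} ∈ K.faces} R₁ →
    ∀ c : X.Chains, X.SupportedIn c K → X.boundary c = 0 → X.augmentation c = 0 →
      ∃ b : X.Chains, X.SupportedIn b (X.nbhd R₂ K) ∧ X.boundary b = c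

/-! ### Coarse Poincaré duality spaces -/

/-- The closed simplex `σ`, as a complex. -/
def closedSimplex (σ : Finset V) : PreAbstractSimplicialComplex V where
  faces := {τ | τ.Nonempty ∧ τ ⊆ σ}
  isRelLowerSet_faces := fun _ h => ⟨h.1, fun _ hρ hne => ⟨hne, hρ.trans h.2⟩⟩

/-- The simplices that occur in the images under `h` of the (co)chains carried by the closed
simplex `σ`; the subcomplex they generate is the support of `h(C(σ))`. -/
def imageSimplices (X : MetricSimplicialComplex V) (h : (X.faces →₀ ℤ) →ₗ[ℤ] (X.faces →₀ ℤ))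
    (σ : X.faces) : Set (Finset V) :=
  {τ | ∃ ρ τ' : X.faces, ρ.1 ⊆ σ.1 ∧ τ' ∈ (h (Finsupp.single ρ 1)).support ∧ τ = τ'.1}

/-- The vertices of the support of `h(C(σ))`. -/
def imageVertices (X : MetricSimplicialComplex V) (h : (X.faces →₀ ℤ) →ₗ[ℤ] (X.faces →₀ ℤ))
    (σ : X.faces) : Set V :=
  {v | ∃ τ ∈ X.imageSimplices h σ, v ∈ τ}

/-- `h` has displacement at most `D`: the support of `h(C(σ))` lies in `N_D(σ)` for each simplex
`σ`. -/
def DisplacementLE (X : MetricSimplicialComplex V) (h : (X.faces →₀ ℤ) →ₗ[ℤ] (X.faces →₀ ℤ))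
    (D : ℕ) : Prop :=
  ∀ σ : X.faces, X.imageSimplices h σ ⊆ (X.nbhd D (closedSimplex σ.1)).faces

/-- A homotopy `Φ` from `f₀` to `f₁` is `L`-Lipschitz.  A homotopy is regarded as a map on the
chains of `X × [0,1]` that restricts to `f₀` and `f₁` at the ends, so for each simplex `σ` the
support of the image of the prism `σ × [0,1]`, which consists of the contributions of `f₀`, `f₁`
and `Φ`, has to have diameter at most `L`. -/
def LipschitzHomotopy (X : MetricSimplicialComplex V)
    (f₀ f₁ Φ : (X.faces →₀ ℤ) →ₗ[ℤ] (X.faces →₀ ℤ)) (L : ℕ) : Prop :=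
  ∀ σ : X.faces,
    X.DiamLE (X.imageVertices f₀ σ ∪ X.imageVertices f₁ σ ∪ X.imageVertices Φ σ) L

/-- A coarse Poincaré duality space of formal dimension `n`.  All (co)chain groups are extended by
zero to negative degrees, so a map `C_*(X) → C_c^{n-*}(X)` or `C_c^{n-*}(X) → C_*(X)` is a
map of total groups that takes a simplex of dimension `k` to a combination of simplices of
dimension `n - k`. -/
def IsCoarsePD [LinearOrder V] (X : MetricSimplicialComplex V) (n : ℤ) : Prop :=
  X.BoundedGeometry ∧ X.UniformlyAcyclic ∧
  ∃ (D₀ : ℕ) (Pbar : X.Chains →ₗ[ℤ] X.Cochains) (P : X.Cochains →ₗ[ℤ] X.Chains),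
    -- degrees
    (∀ σ, ∀ τ ∈ (Pbar (Finsupp.single σ 1)).support, dim σ + dim τ = n) ∧
    (∀ σ, ∀ τ ∈ (P (Finsupp.single σ 1)).support, dim σ + dim τ = n) ∧
    -- chain maps
    (∀ c, X.coboundary (Pbar c) = Pbar (X.boundary c)) ∧
    (∀ α, X.boundary (P α) = P (X.coboundary α)) ∧
    -- bounded displacement
    X.DisplacementLE Pbar D₀ ∧ X.DisplacementLE P D₀ ∧
    -- a Lipschitz chain homotopy from the identity to `P ∘ Pbar` on `C_*(X)`
    (∃ Φ : X.Chains →ₗ[ℤ] X.Chains,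
      (∀ σ, ∀ τ ∈ (Φ (Finsupp.single σ 1)).support, dim τ = dim σ + 1) ∧
      (∀ c, X.boundary (Φ c) + Φ (X.boundary c) = P (Pbar c) - c) ∧
      X.LipschitzHomotopy LinearMap.id (P ∘ₗ Pbar) Φ D₀) ∧
    -- a Lipschitz chain homotopy from the identity to `Pbar ∘ P` on `C_c^*(X)`
    (∃ Φbar : X.Cochains →ₗ[ℤ] X.Cochains,
      (∀ σ, ∀ τ ∈ (Φbar (Finsupp.single σ 1)).support, dim τ = dim σ - 1) ∧
      (∀ α, X.coboundary (Φbar α) + Φbar (X.coboundary α) = Pbar (P α) - α) ∧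
      X.LipschitzHomotopy LinearMap.id (Pbar ∘ₗ P) Φbar D₀)

/-! ### Coarse separation -/

/-- The complement `X - N_R(K)`, as a subspace of the realization of `X`. -/
def complement (X : MetricSimplicialComplex V) (R : ℕ) (K : PreAbstractSimplicialComplex V) :
    Set (V → ℝ) :=
  X.toPreAbstractSimplicialComplex.realization \ (X.nbhd R K).realization

/-- `Y_R`: the closure of `X - N_R(K)` in the realization of `X`. -/
def closedComplement (X : MetricSimplicialComplex V) (R : ℕ)
    (K : PreAbstractSimplicialComplex V) : Set (V → ℝ) :=
  closure (X.complement R K) ∩ X.toPreAbstractSimplicialComplex.realization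

/-- `C` is a connected component of the subspace `U`, and it is deep: it is not contained in a
finite neighbourhood `N_r(K)` of `K`. -/
def IsDeepComponent (X : MetricSimplicialComplex V) (K : PreAbstractSimplicialComplex V)
    (U C : Set (V → ℝ)) : Prop :=
  (∃ x ∈ U, C = connectedComponentIn U x) ∧ ∀ r : ℕ, ¬ C ⊆ (X.nbhd r K).realization

/-- A deep component `C` of `X - N_R(K)` is stable: for every `R' ≥ R` it meets exactly one deep
component of `X - N_{R'}(K)`. -/
def IsStable (X : MetricSimplicialComplex V) (K : PreAbstractSimplicialComplex V) (R : ℕ)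
    (C : Set (V → ℝ)) : Prop :=
  ∀ R' ≥ R, ∃! C', X.IsDeepComponent K (X.complement R' K) C' ∧ (C ∩ C').Nonempty

/-- `K` coarsely separates `X`: for some `R` there are at least two deep components of
`X - N_R(K)`. -/
def CoarselySeparates (X : MetricSimplicialComplex V) (K : PreAbstractSimplicialComplex V) :
    Prop :=
  ∃ (R : ℕ) (C₁ C₂ : Set (V → ℝ)), C₁ ≠ C₂ ∧
    X.IsDeepComponent K (X.complement R K) C₁ ∧ X.IsDeepComponent K (X.complement R K) C₂

/-- `K` coarsely separates `X` into exactly `m` components: for some `R` there are exactly `m`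
deep components of `X - N_R(K)`, and all of them are stable. -/
def CoarselySeparatesInto (X : MetricSimplicialComplex V) (K : PreAbstractSimplicialComplex V)
    (m : ℕ) : Prop :=
  ∃ R : ℕ, {C | X.IsDeepComponent K (X.complement R K) C}.encard = m ∧
    ∀ C, X.IsDeepComponent K (X.complement R K) C → X.IsStable K R C

/-- The point `x` of the realization lies within distance `S` of the set `C`, where the distance
of two points is measured in the 1-skeleton between vertices of the simplices that contain these
points in their interiors. -/
def PointNear (X : MetricSimplicialComplex V) (S : ℕ) (x : V → ℝ) (C : Set (V → ℝ)) : Prop :=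
  ∃ y ∈ C, ∃ v w : V, x v ≠ 0 ∧ y w ≠ 0 ∧ X.dist v w ≤ S

end MetricSimplicialComplex

/-! The argument is Alexander duality in its lowest degree, with control of supports. The cochain
`Pbar c` is the Poincaré dual of a chain `c`. Pulled back along `g`, dualized in `X'` and augmented,
it gives the integer `linking c`, the intersection number of a 1-chain with `g(X')`. It vanishes on
boundaries (`linking_boundary`) and on chains far from `g(X')` (`linking_eq_zero`), so it obstructs
replacing a path with far ends by a far chain with the same ends.

It is the only obstruction. Near `g(X')` there is a coarse retraction `h` to `X'` with `G ∘ h`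
homotopic to the identity. If the pullback of `Pbar c` is a coboundary, then `Pbar c` is itself a
coboundary near `g(X')`. Subtracting that coboundary and applying `P` gives a far chain which, after
a correction by the homotopy `Phi`, has boundary `∂c` (`exists_farFrom_of_coboundary`). By duality
in `X'` the pullback is a coboundary when the linking number is zero
(`exists_farFrom_of_linking_eq_zero`). Relative to `g(Z)` with `Z` coarsely smaller than `X'`, the
linking number can be moved to a vertex of `X'` far from `Z`, and no obstruction remains
(`exists_farFrom_of_unbounded`).

One integer obstruction allows at most two far classes of vertices (`exists_joinedWithin_of_three`).
Two do occur, and near every point of `g(X')`: `P` applied to the retraction pullback of the dual of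
a vertex `v` is a 1-chain near `g v` of linking number one (`exists_linking_eq_one`,
`exists_not_joinedWithin`). This gives both the count of deep components and the uniform bound on
distances to them.

The chain maps and homotopies over vertex maps come from uniform acyclicity, simplex by simplex.
Edge paths avoiding a neighbourhood are matched with topological components at the cost of one unit
of radius. -/

namespace MetricSimplicialComplex

variable {V V' : Type*}

/-! ### The path metric -/

theorem dist_self (X : MetricSimplicialComplex V) (v : V) : X.dist v v = 0 :=
  SimpleGraph.dist_self

theorem dist_comm (X : MetricSimplicialComplex V) (v w : V) : X.dist v w = X.dist w v :=
  SimpleGraph.dist_comm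

theorem dist_triangle (X : MetricSimplicialComplex V) (u v w : V) :
    X.dist u w ≤ X.dist u v + X.dist v w :=
  X.connected.dist_triangle

theorem nonempty_of_mem {X : MetricSimplicialComplex V} {σ : Finset V} (hσ : σ ∈ X.faces) :
    σ.Nonempty :=
  (X.isRelLowerSet_faces hσ).1

theorem mem_faces_of_subset {X : MetricSimplicialComplex V} {σ τ : Finset V} (hσ : σ ∈ X.faces)
    (h : τ ⊆ σ) (hτ : τ.Nonempty) : τ ∈ X.faces :=
  (X.isRelLowerSet_faces hσ).2 h hτ

theorem dist_le_one (X : MetricSimplicialComplex V) {σ : Finset V} (hσ : σ ∈ X.faces) {v w : V}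
    (hv : v ∈ σ) (hw : w ∈ σ) : X.dist v w ≤ 1 := by
  by_cases h : v = w
  · simp [h, dist_self]
  · have hadj : X.oneSkeleton.Adj v w := ⟨h, σ, hσ, hv, hw⟩
    exact (SimpleGraph.dist_eq_one_iff_adj.2 hadj).le

/-- An induction principle for the path metric: a vertex at distance `r + 1` has a neighbour at
distance `r`. -/
theorem exists_adj_of_dist_eq_succ (X : MetricSimplicialComplex V) {v w : V} {r : ℕ}
    (h : X.dist v w = r + 1) : ∃ u, X.dist v u = r ∧ X.oneSkeleton.Adj u w := by
  obtain ⟨p, hp⟩ := X.connected.exists_walk_length_eq_dist v w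
  change p.length = X.dist v w at hp
  have hnil : ¬ p.Nil := by
    intro hn
    have := SimpleGraph.Walk.length_eq_zero_iff.2 hn
    omega
  refine ⟨p.penultimate, ?_, p.adj_penultimate hnil⟩
  have h1 : X.dist v p.penultimate ≤ p.dropLast.length := SimpleGraph.dist_le _
  have h2 : p.dropLast.length = r := by
    simp [hp, h]
  have h3 := X.dist_triangle v p.penultimate w
  have h4 : X.dist p.penultimate w = 1 :=
    SimpleGraph.dist_eq_one_iff_adj.2 (p.adj_penultimate hnil)
  omega

theorem dist_map_le [DecidableEq V] {X : MetricSimplicialComplex V}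
    {X' : MetricSimplicialComplex V'} {g : V' → V} (hg : IsSimplicialMap X' X g) (v w : V') :
    X.dist (g v) (g w) ≤ X'.dist v w := by
  induction h : X'.dist v w generalizing w with
  | zero =>
    have := X'.connected.dist_eq_zero_iff.1 h
    simp [this, dist_self]
  | succ r ih =>
    obtain ⟨u, hu, -, σ, hσ, hus, hws⟩ := X'.exists_adj_of_dist_eq_succ h
    have h1 := ih u hu
    have h2 := X.dist_le_one (hg σ hσ) (Finset.mem_image_of_mem g hus)
      (Finset.mem_image_of_mem g hws)
    have h3 := X.dist_triangle (g v) (g u) (g w)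
    omega

theorem finite_neighbors (X : MetricSimplicialComplex V) (v : V) :
    {w | X.oneSkeleton.Adj v w}.Finite := by
  refine ((X.locallyFinite v).biUnion (t := fun σ => (σ : Set V))
    fun σ _ => σ.finite_toSet).subset ?_
  rintro w ⟨-, σ, hσ, hv, hw⟩
  simp only [Set.mem_iUnion]
  exact ⟨σ, ⟨hσ, hv⟩, hw⟩

theorem finite_ball (X : MetricSimplicialComplex V) (v : V) (r : ℕ) :
    {w | X.dist v w ≤ r}.Finite := by
  induction r with
  | zero =>
    refine (Set.finite_singleton v).subset fun w hw => ?_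
    exact (X.connected.dist_eq_zero_iff.1 (Nat.le_zero.1 hw)).symm
  | succ r ih =>
    refine (ih.union (ih.biUnion fun u _ => X.finite_neighbors u)).subset fun w hw => ?_
    rcases Nat.lt_or_ge r (X.dist v w) with h | h
    · obtain ⟨u, hu, huw⟩ := X.exists_adj_of_dist_eq_succ (le_antisymm hw h)
      refine Or.inr ?_
      simp only [Set.mem_iUnion]
      exact ⟨u, hu.le, huw⟩
    · exact Or.inl h

theorem finite_faces_meeting (X : MetricSimplicialComplex V) {A : Set V} (hA : A.Finite) :
    {σ : X.faces | ∃ v ∈ σ.1, v ∈ A}.Finite := by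
  refine Set.Finite.of_injOn (f := Subtype.val) (t := ⋃ v ∈ A, {σ ∈ X.faces | v ∈ σ}) ?_
    Subtype.val_injective.injOn (hA.biUnion fun v _ => X.locallyFinite v)
  rintro σ ⟨v, hv, hvA⟩
  simp only [Set.mem_iUnion]
  exact ⟨v, hvA, σ.2, hv⟩

/-- The other vertices of a simplex containing `v` are distinct singletons in the link of `{v}`. The
bound makes inductions over skeleta finite, so that displacement constants stay finite. -/
theorem exists_card_le [DecidableEq V] {X : MetricSimplicialComplex V} (hX : X.BoundedGeometry) :
    ∃ N : ℕ, ∀ σ ∈ X.faces, σ.card ≤ N := by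
  obtain ⟨N, hN⟩ := hX
  refine ⟨N + 1, fun σ hσ => ?_⟩
  obtain ⟨v, hv⟩ := nonempty_of_mem hσ
  have hinj : Set.InjOn (fun w : V => ({w} : Finset V)) ((σ.erase v : Finset V) : Set V) :=
    Finset.singleton_injective.injOn
  have hsub : (fun w : V => ({w} : Finset V)) '' ((σ.erase v : Finset V) : Set V) ⊆
      X.link {v} := by
    rintro _ ⟨w, hw, rfl⟩
    have hw' := Finset.mem_erase.1 (Finset.mem_coe.1 hw)
    refine ⟨Finset.singleton_nonempty w, by simpa using hw'.1.symm, ?_⟩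
    refine mem_faces_of_subset hσ ?_ ⟨v, by simp⟩
    intro x hx
    simp only [Finset.mem_union, Finset.mem_singleton] at hx
    rcases hx with rfl | rfl
    · exact hv
    · exact hw'.2
  have h1 := (Set.encard_le_encard hsub).trans (hN {v} (X.singleton_mem v))
  rw [hinj.encard_image, Set.encard_coe_eq_coe_finsetCard, Finset.card_erase_of_mem hv] at h1
  have h2 : σ.card - 1 ≤ N := by exact_mod_cast h1
  omega

theorem exists_dist_le_of_uniformlyProper {X : MetricSimplicialComplex V}
    {X' : MetricSimplicialComplex V'} {g : V' → V} (hg : IsUniformlyProper X' X g) :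
    ∃ ρ : ℕ → ℕ, ∀ t v w, X.dist (g v) (g w) ≤ t → X'.dist v w ≤ ρ t := by
  obtain ⟨-, φ, hφ, h⟩ := hg
  have : ∀ t : ℕ, ∃ r : ℕ, ∀ v w, X.dist (g v) (g w) ≤ t → X'.dist v w ≤ r := by
    intro t
    obtain ⟨a, ha⟩ := Filter.eventually_atTop.1 (hφ.eventually_gt_atTop (t : ℝ≥0))
    refine ⟨⌈a⌉₊, fun v w hvw => ?_⟩
    by_contra hlt
    have h1 := ha (X'.dist v w) ((Nat.le_ceil a).trans (by exact_mod_cast (not_le.1 hlt).le))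
    have h2 := h1.trans_le (h v w)
    have h3 : t < X.dist (g v) (g w) := by exact_mod_cast h2
    omega
  choose ρ hρ using this
  exact ⟨ρ, hρ⟩

/-! ### Tubular neighbourhoods -/

theorem nbhd_succ (X : MetricSimplicialComplex V) (r : ℕ) (K : PreAbstractSimplicialComplex V) :
    X.nbhd (r + 1) K = X.closedStar (X.nbhd r K) :=
  Function.iterate_succ_apply' _ _ _

theorem exists_dist_le_of_mem_nbhd (X : MetricSimplicialComplex V) {r : ℕ}
    {K : PreAbstractSimplicialComplex V} {σ : Finset V} (hσ : σ ∈ (X.nbhd r K).faces) {v : V}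
    (hv : v ∈ σ) : ∃ k, {k} ∈ K.faces ∧ X.dist k v ≤ r := by
  induction r generalizing σ v with
  | zero =>
    exact ⟨v, (K.isRelLowerSet_faces hσ).2 (Finset.singleton_subset_iff.2 hv)
      (Finset.singleton_nonempty v), by simp [dist_self]⟩
  | succ r ih =>
    rw [nbhd_succ] at hσ
    obtain ⟨-, τ, hτ, hστ, u, hu, huK⟩ := hσ
    obtain ⟨k, hk, hku⟩ := ih huK (Finset.mem_singleton_self u)
    have h1 := X.dist_le_one hτ hu (hστ hv)
    have h2 := X.dist_triangle k u v
    exact ⟨k, hk, by omega⟩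

theorem singleton_mem_nbhd (X : MetricSimplicialComplex V) {r : ℕ}
    {K : PreAbstractSimplicialComplex V} {k v : V} (hk : {k} ∈ K.faces) (h : X.dist k v ≤ r) :
    {v} ∈ (X.nbhd r K).faces := by
  induction r generalizing v with
  | zero =>
    rw [← X.connected.dist_eq_zero_iff.1 (Nat.le_zero.1 h)]
    exact hk
  | succ r ih =>
    rw [nbhd_succ]
    rcases Nat.lt_or_ge r (X.dist k v) with h' | h'
    · obtain ⟨u, hu, -, σ, hσ, hus, hvs⟩ := X.exists_adj_of_dist_eq_succ (le_antisymm h h')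
      exact ⟨Finset.singleton_nonempty v, σ, hσ, Finset.singleton_subset_iff.2 hvs, u, hus,
        ih hu.le⟩
    · exact ⟨Finset.singleton_nonempty v, {v}, X.singleton_mem v, subset_rfl, v,
        Finset.mem_singleton_self v, ih h'⟩

/-- The inequality is strict because the last closed star is spent on passing from the vertex `v` to
the simplices around it. -/
theorem mem_nbhd_of_dist_lt (X : MetricSimplicialComplex V) {r : ℕ}
    {K : PreAbstractSimplicialComplex V} {σ : Finset V} (hσ : σ ∈ X.faces) {k v : V} (hv : v ∈ σ)
    (hk : {k} ∈ K.faces) (h : X.dist k v < r) : σ ∈ (X.nbhd r K).faces := by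
  obtain ⟨r, rfl⟩ := Nat.exists_eq_succ_of_ne_zero (Nat.ne_of_gt (Nat.zero_lt_of_lt h))
  rw [Nat.succ_eq_add_one, nbhd_succ]
  exact ⟨nonempty_of_mem hσ, σ, hσ, subset_rfl, v, hv,
    X.singleton_mem_nbhd hk (Nat.lt_succ_iff.1 h)⟩

end MetricSimplicialComplex

/-! ### Finitely supported functions -/

/-- Agreement is needed only on the support of `c`. With `T₂ = 0` or with maps that behave well only
on part of the complex, this is the basic locality argument. -/
theorem Finsupp.map_eq_of_forall_single {ι M : Type*} [AddCommGroup M]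
    (T₁ T₂ : (ι →₀ ℤ) →ₗ[ℤ] M) {c : ι →₀ ℤ}
    (h : ∀ σ ∈ c.support, T₁ (Finsupp.single σ 1) = T₂ (Finsupp.single σ 1)) : T₁ c = T₂ c := by
  rw [← c.sum_single, Finsupp.sum, map_sum, map_sum]
  refine Finset.sum_congr rfl fun σ hσ => ?_
  have := congrArg (fun x => c σ • x) (h σ hσ)
  simpa [← map_smul] using this

theorem Finsupp.exists_mem_support_of_mem_support_map {ι κ : Type*}
    (T : (ι →₀ ℤ) →ₗ[ℤ] (κ →₀ ℤ)) {c : ι →₀ ℤ} {τ : κ} (h : τ ∈ (T c).support) :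
    ∃ σ ∈ c.support, τ ∈ (T (Finsupp.single σ 1)).support := by
  by_contra! hn
  refine Finsupp.mem_support_iff.1 h
    (Finsupp.map_eq_of_forall_single (Finsupp.lapply τ ∘ₗ T) 0 fun σ hσ => ?_)
  simpa using hn σ hσ

/-- The evaluation of a finitely supported cochain on a chain. -/
noncomputable def Finsupp.pairing {ι : Type*} (α : ι →₀ ℤ) : (ι →₀ ℤ) →ₗ[ℤ] ℤ :=
  Finsupp.linearCombination ℤ α

theorem Finsupp.pairing_single {ι : Type*} (α : ι →₀ ℤ) (σ : ι) :
    Finsupp.pairing α (Finsupp.single σ 1) = α σ := by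
  simp [Finsupp.pairing]

theorem Finsupp.pairing_sub {ι : Type*} (α β : ι →₀ ℤ) (c : ι →₀ ℤ) :
    Finsupp.pairing (α - β) c = Finsupp.pairing α c - Finsupp.pairing β c := by
  rw [← LinearMap.sub_apply]
  exact Finsupp.map_eq_of_forall_single _ _ fun σ _ => by simp [Finsupp.pairing_single]

theorem Finsupp.pairing_add {ι : Type*} (α β : ι →₀ ℤ) (c : ι →₀ ℤ) :
    Finsupp.pairing (α + β) c = Finsupp.pairing α c + Finsupp.pairing β c := by
  rw [← sub_eq_iff_eq_add, ← Finsupp.pairing_sub, add_sub_cancel_right]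

theorem Finsupp.pairing_comm {ι : Type*} (α c : ι →₀ ℤ) :
    Finsupp.pairing α c = Finsupp.pairing c α := by
  classical
  unfold Finsupp.pairing
  rw [Finsupp.linearCombination_apply, Finsupp.linearCombination_apply,
    Finsupp.sum_of_support_subset c (Finset.subset_union_left (s₂ := α.support)) _ (by simp),
    Finsupp.sum_of_support_subset α (Finset.subset_union_right (s₁ := c.support)) _ (by simp)]
  exact Finset.sum_congr rfl fun σ _ => mul_comm _ _

theorem Finsupp.pairing_congr {ι : Type*} {α β : ι →₀ ℤ} {c : ι →₀ ℤ}
    (h : ∀ σ ∈ c.support, α σ = β σ) : Finsupp.pairing α c = Finsupp.pairing β c := by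
  rw [← sub_eq_zero, ← Finsupp.pairing_sub]
  refine Finsupp.map_eq_of_forall_single _ 0 fun σ hσ => ?_
  simp [Finsupp.pairing_single, h σ hσ]

theorem Finsupp.pairing_eq_zero {ι : Type*} {α : ι →₀ ℤ} {c : ι →₀ ℤ}
    (h : ∀ σ ∈ c.support, α σ = 0) : Finsupp.pairing α c = 0 :=
  Finsupp.map_eq_of_forall_single _ 0 fun σ hσ => by simp [Finsupp.pairing_single, h σ hσ]

/-- A linear map is proper if each basis element occurs in only finitely many images of basis
elements, so that the transpose preserves finitely supported functions. -/
def Finsupp.IsProper {ι κ : Type*} (T : (ι →₀ ℤ) →ₗ[ℤ] (κ →₀ ℤ)) : Prop :=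
  ∀ τ, {σ | τ ∈ (T (Finsupp.single σ 1)).support}.Finite

/-- The transpose of a proper map. -/
noncomputable def Finsupp.transpose {ι κ : Type*} (T : (ι →₀ ℤ) →ₗ[ℤ] (κ →₀ ℤ))
    (hT : Finsupp.IsProper T) : (κ →₀ ℤ) →ₗ[ℤ] (ι →₀ ℤ) :=
  (AddMonoidHom.mk' (fun α : κ →₀ ℤ => Finsupp.ofSupportFinite
    (fun σ => Finsupp.pairing α (T (Finsupp.single σ 1))) <| by
      refine (α.support.finite_toSet.biUnion fun τ _ => hT τ).subset fun σ hσ => ?_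
      by_contra hn
      simp only [Set.mem_iUnion, not_exists] at hn
      refine hσ (Finsupp.pairing_eq_zero fun τ hτ => ?_)
      by_contra h
      exact hn τ (by simpa using h) hτ) fun α β => by
    ext σ
    exact Finsupp.pairing_add α β _).toIntLinearMap

theorem Finsupp.transpose_apply {ι κ : Type*} (T : (ι →₀ ℤ) →ₗ[ℤ] (κ →₀ ℤ))
    (hT : Finsupp.IsProper T) (α : κ →₀ ℤ) (σ : ι) :
    Finsupp.transpose T hT α σ = Finsupp.pairing α (T (Finsupp.single σ 1)) := rfl

theorem Finsupp.pairing_transpose {ι κ : Type*} (T : (ι →₀ ℤ) →ₗ[ℤ] (κ →₀ ℤ))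
    (hT : Finsupp.IsProper T) (α : κ →₀ ℤ) (c : ι →₀ ℤ) :
    Finsupp.pairing (Finsupp.transpose T hT α) c = Finsupp.pairing α (T c) := by
  rw [← LinearMap.comp_apply]
  refine Finsupp.map_eq_of_forall_single _ _ fun σ _ => ?_
  rw [Finsupp.pairing_single, Finsupp.transpose_apply, LinearMap.comp_apply]

theorem Finsupp.exists_mem_support_of_transpose {ι κ : Type*} (T : (ι →₀ ℤ) →ₗ[ℤ] (κ →₀ ℤ))
    (hT : Finsupp.IsProper T) {α : κ →₀ ℤ} {σ : ι}
    (h : σ ∈ (Finsupp.transpose T hT α).support) :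
    ∃ τ ∈ α.support, τ ∈ (T (Finsupp.single σ 1)).support := by
  by_contra! hn
  rw [Finsupp.mem_support_iff, Finsupp.transpose_apply] at h
  refine h (Finsupp.pairing_eq_zero fun τ hτ => ?_)
  by_contra h'
  exact hn τ (by simpa using h') hτ

namespace MetricSimplicialComplex

variable {V V' : Type*}

/-! ### Augmentations -/

/-- The augmentation with weights `q`: the weighted sum of the coefficients of the vertices. -/
noncomputable def weightedAugmentation (X : MetricSimplicialComplex V) (q : V → ℤ) :
    X.Chains →ₗ[ℤ] ℤ :=
  Finsupp.linearCombination ℤ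
    (fun σ : X.faces => if σ.1.card = 1 then ∑ v ∈ σ.1, q v else 0)

theorem weightedAugmentation_one (X : MetricSimplicialComplex V) :
    X.weightedAugmentation (fun _ => 1) = X.augmentation := by
  refine LinearMap.ext fun c => Finsupp.map_eq_of_forall_single _ _ fun σ _ => ?_
  simp only [weightedAugmentation, augmentation, Finsupp.linearCombination_single, one_smul,
    Finset.sum_const, nsmul_eq_mul, mul_one]
  split_ifs with h <;> simp [h]

/-- The vertex `v` as a chain. -/
noncomputable def vertexChain (X : MetricSimplicialComplex V) (v : V) : X.Chains :=
  Finsupp.single ⟨{v}, X.singleton_mem v⟩ 1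

theorem weightedAugmentation_vertexChain (X : MetricSimplicialComplex V) (q : V → ℤ) (v : V) :
    X.weightedAugmentation q (X.vertexChain v) = q v := by
  simp [weightedAugmentation, vertexChain]

theorem augmentation_vertexChain (X : MetricSimplicialComplex V) (v : V) :
    X.augmentation (X.vertexChain v) = 1 := by
  simp [augmentation, vertexChain]

theorem augmentation_eq_zero (X : MetricSimplicialComplex V) {c : X.Chains}
    (h : ∀ τ ∈ c.support, τ.1.card ≠ 1) : X.augmentation c = 0 :=
  Finsupp.map_eq_of_forall_single _ 0 fun τ hτ => by simp [augmentation, h τ hτ]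

/-! ### The boundary operator -/

section Boundary

variable [LinearOrder V]

theorem incidence_erase {τ : Finset V} {v : V} (hv : v ∈ τ) :
    incidence τ (τ.erase v) = (-1) ^ (τ.filter (· < v)).card := by
  unfold incidence
  rw [Finset.sum_eq_single_of_mem v hv]
  · simp
  · intro w hw hwv
    rw [if_neg]
    intro h
    have : v ∈ τ.erase w := Finset.mem_erase.2 ⟨hwv.symm, hv⟩
    rw [h] at this
    simp at this

theorem exists_eq_erase_of_incidence_ne_zero {τ σ : Finset V} (h : incidence τ σ ≠ 0) :
    ∃ v ∈ τ, τ.erase v = σ := by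
  obtain ⟨v, hv, hv'⟩ := Finset.exists_ne_zero_of_sum_ne_zero h
  by_cases hvs : τ.erase v = σ
  · exact ⟨v, hv, hvs⟩
  · simp [hvs] at hv'

theorem card_of_incidence_ne_zero {τ σ : Finset V} (h : incidence τ σ ≠ 0) :
    σ.card + 1 = τ.card := by
  obtain ⟨v, hv, rfl⟩ := exists_eq_erase_of_incidence_ne_zero h
  exact Finset.card_erase_add_one hv

theorem boundary_single_apply (X : MetricSimplicialComplex V) (τ σ : X.faces) :
    X.boundary (Finsupp.single τ 1) σ = incidence τ.1 σ.1 := by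
  simp only [boundary, Finsupp.linearCombination_single, one_smul]
  rfl

theorem coboundary_single_apply (X : MetricSimplicialComplex V) (τ σ : X.faces) :
    X.coboundary (Finsupp.single σ 1) τ = incidence τ.1 σ.1 := by
  simp only [coboundary, Finsupp.linearCombination_single, one_smul]
  rfl

theorem card_of_mem_support_boundary (X : MetricSimplicialComplex V) {τ σ : X.faces}
    (h : σ ∈ (X.boundary (Finsupp.single τ 1)).support) : σ.1.card + 1 = τ.1.card := by
  rw [Finsupp.mem_support_iff, boundary_single_apply] at h
  exact card_of_incidence_ne_zero h

theorem subset_of_mem_support_boundary (X : MetricSimplicialComplex V) {τ σ : X.faces}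
    (h : σ ∈ (X.boundary (Finsupp.single τ 1)).support) : σ.1 ⊆ τ.1 := by
  rw [Finsupp.mem_support_iff, boundary_single_apply] at h
  exact subset_of_incidence_ne_zero h

theorem coboundary_apply (X : MetricSimplicialComplex V) (α : X.Cochains) (τ : X.faces) :
    X.coboundary α τ = Finsupp.pairing α (X.boundary (Finsupp.single τ 1)) := by
  rw [Finsupp.pairing_comm]
  refine Finsupp.map_eq_of_forall_single (Finsupp.lapply τ ∘ₗ X.coboundary) _ fun σ _ => ?_
  rw [Finsupp.pairing_single, LinearMap.comp_apply, Finsupp.lapply_apply,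
    coboundary_single_apply, boundary_single_apply]

theorem pairing_coboundary (X : MetricSimplicialComplex V) (α : X.Cochains) (c : X.Chains) :
    Finsupp.pairing (X.coboundary α) c = Finsupp.pairing α (X.boundary c) := by
  rw [← LinearMap.comp_apply]
  refine Finsupp.map_eq_of_forall_single _ _ fun τ _ => ?_
  rw [Finsupp.pairing_single, LinearMap.comp_apply, coboundary_apply]

/-- The condition `q ∅ = 0` accounts for the face of a vertex: it is empty and is not a simplex of
`X`. -/
theorem linearCombination_boundary_single (X : MetricSimplicialComplex V) (q : Finset V → ℤ)
    (hq : q ∅ = 0) (ρ : X.faces) :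
    Finsupp.linearCombination ℤ (fun τ : X.faces => q τ.1) (X.boundary (Finsupp.single ρ 1)) =
      ∑ v ∈ ρ.1, (-1) ^ (ρ.1.filter (· < v)).card * q (ρ.1.erase v) := by
  have hne : ∀ v, (-1) ^ (ρ.1.filter (· < v)).card * q (ρ.1.erase v) ≠ 0 →
      (ρ.1.erase v).Nonempty := by
    intro v h
    rw [Finset.nonempty_iff_ne_empty]
    intro h'
    rw [h', hq, mul_zero] at h
    exact h rfl
  rw [Finsupp.linearCombination_apply, Finsupp.sum]
  symm
  refine Finset.sum_bij_ne_zero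
    (fun v _ h => ⟨ρ.1.erase v, mem_faces_of_subset ρ.2 (Finset.erase_subset _ _) (hne v h)⟩)
    ?_ ?_ ?_ ?_
  · intro v hv h
    rw [Finsupp.mem_support_iff, boundary_single_apply, incidence_erase hv]
    exact pow_ne_zero _ (by norm_num)
  · intro v hv _ w hw _ h
    exact Finset.erase_injOn ρ.1 hv hw (congrArg Subtype.val h)
  · intro τ hτ h
    rw [Finsupp.mem_support_iff, boundary_single_apply] at hτ
    obtain ⟨v, hv, hvτ⟩ := exists_eq_erase_of_incidence_ne_zero hτ
    refine ⟨v, hv, ?_, Subtype.ext hvτ⟩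
    rw [boundary_single_apply, ← hvτ, incidence_erase hv, smul_eq_mul] at h
    exact h
  · intro v hv h
    rw [boundary_single_apply, incidence_erase hv, smul_eq_mul]

theorem sign_erase_mul_sign_erase {ρ : Finset V} {v w : V} (hv : v ∈ ρ) (h : v < w) :
    ((-1) ^ (ρ.filter (· < w)).card * (-1) ^ ((ρ.erase w).filter (· < v)).card : ℤ) =
      -((-1) ^ (ρ.filter (· < v)).card * (-1) ^ ((ρ.erase v).filter (· < w)).card) := by
  have h1 : (ρ.erase w).filter (· < v) = ρ.filter (· < v) := by
    ext x
    simp only [Finset.mem_filter, Finset.mem_erase]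
    exact ⟨fun hx => ⟨hx.1.2, hx.2⟩, fun hx => ⟨⟨(hx.2.trans h).ne, hx.1⟩, hx.2⟩⟩
  have h2 : (ρ.filter (· < w)).card = ((ρ.erase v).filter (· < w)).card + 1 := by
    rw [Finset.filter_erase, Finset.card_erase_add_one]
    exact Finset.mem_filter.2 ⟨hv, h⟩
  rw [h1, h2, pow_succ]
  ring

/-- Each codimension-two face arises by deleting two vertices in either order. Interchanging the
order is a fixed-point-free involution that reverses the sign. -/
theorem sum_incidence_erase (ρ σ : Finset V) :
    ∑ v ∈ ρ, (-1) ^ (ρ.filter (· < v)).card * incidence (ρ.erase v) σ = 0 := by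
  unfold incidence
  simp_rw [Finset.mul_sum, mul_ite, mul_zero]
  rw [Finset.sum_sigma']
  refine Finset.sum_involution (fun p _ => ⟨p.2, p.1⟩) ?_ ?_ ?_ ?_
  · rintro ⟨v, w⟩ hp
    simp only [Finset.mem_sigma, Finset.mem_erase] at hp
    obtain ⟨hv, hwv, hw⟩ := hp
    dsimp only
    rw [Finset.erase_right_comm (a := w) (b := v)]
    split_ifs
    · rcases lt_or_gt_of_ne hwv with h | h
      · rw [sign_erase_mul_sign_erase hw h]
        ring
      · rw [sign_erase_mul_sign_erase hv h]
        ring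
    · simp
  · rintro ⟨v, w⟩ hp _ h
    simp only [Finset.mem_sigma, Finset.mem_erase] at hp
    simp only [Sigma.mk.injEq] at h
    exact hp.2.1 h.1
  · rintro ⟨v, w⟩ hp
    simp only [Finset.mem_sigma, Finset.mem_erase] at hp ⊢
    exact ⟨hp.2.2, hp.2.1.symm, hp.1⟩
  · rintro ⟨v, w⟩ _
    rfl

theorem boundary_boundary (X : MetricSimplicialComplex V) (c : X.Chains) :
    X.boundary (X.boundary c) = 0 := by
  rw [← LinearMap.comp_apply]
  refine Finsupp.map_eq_of_forall_single _ 0 fun ρ _ => ?_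
  ext σ
  have h1 : ∀ c : X.Chains, X.boundary c σ =
      Finsupp.linearCombination ℤ (fun τ : X.faces => incidence τ.1 σ.1) c := fun c =>
    Finsupp.map_eq_of_forall_single (Finsupp.lapply σ ∘ₗ X.boundary) _ fun τ _ => by
      simp [boundary_single_apply]
  rw [LinearMap.comp_apply, h1,
    linearCombination_boundary_single X (fun τ => incidence τ σ.1) (by simp [incidence]),
    sum_incidence_erase]
  rfl

theorem coboundary_coboundary (X : MetricSimplicialComplex V) (α : X.Cochains) :
    X.coboundary (X.coboundary α) = 0 := by
  ext σ
  rw [coboundary_apply, pairing_coboundary, boundary_boundary, map_zero, Finsupp.zero_apply]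

theorem boundary_single_of_card_eq_one (X : MetricSimplicialComplex V) {σ : X.faces}
    (h : σ.1.card = 1) : X.boundary (Finsupp.single σ 1) = 0 := by
  ext τ
  rw [boundary_single_apply, Finsupp.zero_apply]
  by_contra h'
  have h1 := card_of_incidence_ne_zero h'
  have h2 := Finset.card_pos.2 (nonempty_of_mem τ.2)
  omega

theorem boundary_vertexChain (X : MetricSimplicialComplex V) (v : V) :
    X.boundary (X.vertexChain v) = 0 :=
  X.boundary_single_of_card_eq_one (by simp)

theorem boundary_edge (X : MetricSimplicialComplex V) {a b : V} (hab : a < b)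
    (h : {a, b} ∈ X.faces) :
    X.boundary (Finsupp.single ⟨{a, b}, h⟩ 1) = X.vertexChain b - X.vertexChain a := by
  have hf : ∀ x : V, ({a, b} : Finset V).filter (· < x) =
      (if a < x then {a} else ∅) ∪ (if b < x then {b} else ∅) := by
    intro x
    ext y
    simp only [Finset.mem_filter, Finset.mem_insert, Finset.mem_singleton, Finset.mem_union]
    split_ifs <;> simp <;> grind
  have ha : ({a, b} : Finset V).erase a = {b} := by ext; simp; grind
  have hb : ({a, b} : Finset V).erase b = {a} := by ext; simp; grind
  ext σ
  rw [boundary_single_apply, incidence, Finset.sum_pair hab.ne, ha, hb, hf, hf]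
  simp only [lt_self_iff_false, hab, hab.not_gt, if_true, if_false, vertexChain,
    Finsupp.sub_apply, Finsupp.single_apply, Subtype.ext_iff,
    Finset.union_empty, Finset.card_empty, pow_zero, Finset.card_singleton, pow_one]
  split_ifs <;> rfl

theorem weightedAugmentation_boundary_single (X : MetricSimplicialComplex V) (q : V → ℤ)
    (τ : X.faces) (h : ∀ v ∈ τ.1, ∀ w ∈ τ.1, q v = q w) :
    X.weightedAugmentation q (X.boundary (Finsupp.single τ 1)) = 0 := by
  by_cases hc : τ.1.card = 2
  · obtain ⟨a, b, hab, hτ⟩ := Finset.card_eq_two.1 hc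
    wlog hlt : a < b generalizing a b
    · exact this b a hab.symm (hτ.trans (Finset.pair_comm a b))
        (lt_of_le_of_ne (not_lt.1 hlt) hab.symm)
    have h1 : τ = ⟨{a, b}, hτ ▸ τ.2⟩ := Subtype.ext hτ
    rw [h1, boundary_edge X hlt, map_sub, weightedAugmentation_vertexChain,
      weightedAugmentation_vertexChain, sub_eq_zero]
    exact h b (by simp [hτ]) a (by simp [hτ])
  · refine Finsupp.map_eq_of_forall_single _ 0 fun σ hσ => ?_
    have := X.card_of_mem_support_boundary hσ
    simp only [weightedAugmentation, Finsupp.linearCombination_single, one_smul]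
    rw [if_neg (by omega)]
    rfl

/-- Only edges contribute, each by the difference of `q` at its ends. With `q` the indicator of a
path component this detects chains that cannot leave the component. -/
theorem weightedAugmentation_boundary (X : MetricSimplicialComplex V) (q : V → ℤ) (c : X.Chains)
    (h : ∀ τ ∈ c.support, ∀ v ∈ τ.1, ∀ w ∈ τ.1, q v = q w) :
    X.weightedAugmentation q (X.boundary c) = 0 := by
  rw [← LinearMap.comp_apply]
  exact Finsupp.map_eq_of_forall_single _ 0 fun τ hτ =>
    X.weightedAugmentation_boundary_single q τ (h τ hτ)

theorem augmentation_boundary (X : MetricSimplicialComplex V) (c : X.Chains) :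
    X.augmentation (X.boundary c) = 0 := by
  rw [← weightedAugmentation_one]
  exact X.weightedAugmentation_boundary _ c fun _ _ _ _ _ _ => rfl

theorem boundary_eq_zero_of_card (X : MetricSimplicialComplex V) {c : X.Chains}
    (h : ∀ τ ∈ c.support, τ.1.card = 1) : X.boundary c = 0 :=
  Finsupp.map_eq_of_forall_single _ 0 fun τ hτ => by
    simp [X.boundary_single_of_card_eq_one (h τ hτ)]

theorem boundary_apply (X : MetricSimplicialComplex V) (c : X.Chains) (σ : X.faces) :
    X.boundary c σ = Finsupp.pairing c (X.coboundary (Finsupp.single σ 1)) := by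
  rw [Finsupp.pairing_comm, pairing_coboundary, Finsupp.pairing_comm, Finsupp.pairing_single]

/-- The chain group is the total one. Since `∂` lowers cardinality by exactly one, homogeneous parts
can be cut out by a filter. -/
theorem boundary_filter_card_apply (X : MetricSimplicialComplex V) (c : X.Chains) (m : ℕ)
    (σ : X.faces) : X.boundary (c.filter fun τ => τ.1.card = m + 1) σ =
      if σ.1.card = m then X.boundary c σ else 0 := by
  have hcard : ∀ τ ∈ (X.coboundary (Finsupp.single σ 1)).support, σ.1.card + 1 = τ.1.card := by
    intro τ hτ
    rw [Finsupp.mem_support_iff, coboundary_single_apply] at hτ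
    exact card_of_incidence_ne_zero hτ
  rw [boundary_apply, boundary_apply]
  split_ifs with h
  · refine Finsupp.pairing_congr fun τ hτ => Finsupp.filter_apply_pos _ _ ?_
    rw [← hcard τ hτ, h]
  · refine Finsupp.pairing_eq_zero fun τ hτ => Finsupp.filter_apply_neg _ _ ?_
    rw [← hcard τ hτ]
    omega

theorem boundary_filter_card (X : MetricSimplicialComplex V) {c : X.Chains} {m : ℕ}
    (h : ∀ σ ∈ (X.boundary c).support, σ.1.card = m) :
    X.boundary (c.filter fun τ => τ.1.card = m + 1) = X.boundary c := by
  ext σ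
  rw [boundary_filter_card_apply]
  split_ifs with h'
  · rfl
  · by_contra h0
    exact h' (h σ (Finsupp.mem_support_iff.2 (Ne.symm h0)))

end Boundary

end MetricSimplicialComplex

namespace MetricSimplicialComplex

variable {V V' W : Type*}

/-! ### Maps of bounded displacement -/

/-- On simplices with vertices in `S`, the map `T` has displacement at most `L` with respect to the
vertex map `φ`. -/
def HasDisplacement (X : MetricSimplicialComplex V) (Y : MetricSimplicialComplex W) (S : Set V)
    (φ : V → W) (L : ℕ) (T : X.Chains →ₗ[ℤ] Y.Chains) : Prop :=
  ∀ σ : X.faces, (σ.1 : Set V) ⊆ S → ∀ τ ∈ (T (Finsupp.single σ 1)).support,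
    ∀ u ∈ σ.1, ∀ w ∈ τ.1, Y.dist (φ u) w ≤ L

/-- A simplex hitting `τ` must lie in `S` and have a vertex in the finite set of `hfin`; local
finiteness leaves finitely many. -/
theorem isProper_of_hasDisplacement {X : MetricSimplicialComplex V}
    {Y : MetricSimplicialComplex W} {S : Set V} {φ : V → W} {L : ℕ} {T : X.Chains →ₗ[ℤ] Y.Chains}
    (h : HasDisplacement X Y S φ L T)
    (hT : ∀ σ : X.faces, ¬ (σ.1 : Set V) ⊆ S → T (Finsupp.single σ 1) = 0)
    (hfin : ∀ w, {u ∈ S | Y.dist (φ u) w ≤ L}.Finite) : Finsupp.IsProper T := by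
  intro τ
  obtain ⟨w, hw⟩ := nonempty_of_mem τ.2
  refine (X.finite_faces_meeting (hfin w)).subset fun σ hσ => ?_
  have hσ' : τ ∈ (T (Finsupp.single σ 1)).support := hσ
  have hσS : (σ.1 : Set V) ⊆ S := by
    by_contra hn
    simp [hT σ hn] at hσ'
  obtain ⟨u, hu⟩ := nonempty_of_mem σ.2
  exact ⟨u, hu, hσS hu, h σ hσS τ hσ' u hu w hw⟩

/-- All vertices of the simplices of `c` have distance at least `r` from `K`. -/
def FarFrom (X : MetricSimplicialComplex V) (K : Set V) (r : ℕ) (c : X.Chains) : Prop :=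
  ∀ τ ∈ c.support, ∀ w ∈ τ.1, ∀ k ∈ K, r ≤ X.dist k w

theorem FarFrom.mono {X : MetricSimplicialComplex V} {K : Set V} {r r' : ℕ} {c : X.Chains}
    (h : X.FarFrom K r c) (hr : r' ≤ r) : X.FarFrom K r' c :=
  fun τ hτ w hw k hk => hr.trans (h τ hτ w hw k hk)

theorem FarFrom.sub {X : MetricSimplicialComplex V} {K : Set V} {r : ℕ} {c c' : X.Chains}
    (h : X.FarFrom K r c) (h' : X.FarFrom K r c') : X.FarFrom K r (c - c') := by
  classical
  intro τ hτ
  rcases Finset.mem_union.1 (Finsupp.support_sub hτ) with hτ | hτ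
  · exact h τ hτ
  · exact h' τ hτ

theorem FarFrom.map {X : MetricSimplicialComplex V} {K : Set V} {r D : ℕ}
    {T : X.Chains →ₗ[ℤ] X.Chains} (hT : HasDisplacement X X Set.univ id D T) {c : X.Chains}
    (h : X.FarFrom K (r + D) c) : X.FarFrom K r (T c) := by
  intro τ hτ w hw k hk
  obtain ⟨σ, hσ, hτσ⟩ := Finsupp.exists_mem_support_of_mem_support_map T hτ
  obtain ⟨u, hu⟩ := nonempty_of_mem σ.2
  have h1 : X.dist u w ≤ D := hT σ (Set.subset_univ _) τ hτσ u hu w hw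
  have h2 := h σ hσ u hu k hk
  have h3 := X.dist_triangle k w u
  have h4 := X.dist_comm u w
  omega

/-- All vertices of the simplices of `c` have distance at most `r` from `v`. -/
def NearTo (X : MetricSimplicialComplex V) (v : V) (r : ℕ) (c : X.Chains) : Prop :=
  ∀ τ ∈ c.support, ∀ w ∈ τ.1, X.dist v w ≤ r

theorem NearTo.map {X : MetricSimplicialComplex V} {v : V} {r D : ℕ}
    {T : X.Chains →ₗ[ℤ] X.Chains} (hT : HasDisplacement X X Set.univ id D T) {c : X.Chains}
    (h : X.NearTo v r c) : X.NearTo v (r + D) (T c) := by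
  intro τ hτ w hw
  obtain ⟨σ, hσ, hτσ⟩ := Finsupp.exists_mem_support_of_mem_support_map T hτ
  obtain ⟨u, hu⟩ := nonempty_of_mem σ.2
  have h1 : X.dist u w ≤ D := hT σ (Set.subset_univ _) τ hτσ u hu w hw
  have h2 := h σ hσ u hu
  have h3 := X.dist_triangle v u w
  omega

/-- The neighbourhood `N_D(σ)` controls the distance to some vertex of `σ`; control from every
vertex of `σ` costs one more. -/
theorem DisplacementLE.hasDisplacement {X : MetricSimplicialComplex V}
    {h : X.Chains →ₗ[ℤ] X.Chains} {D : ℕ} (hD : X.DisplacementLE h D) :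
    HasDisplacement X X Set.univ id (D + 1) h := by
  intro σ _ τ hτ u hu w hw
  have hτσ : τ.1 ∈ X.imageSimplices h σ := ⟨σ, τ, subset_rfl, hτ, rfl⟩
  obtain ⟨k, hk, hkw⟩ := X.exists_dist_le_of_mem_nbhd (hD σ hτσ) hw
  have h1 := X.dist_le_one σ.2 hu (hk.2 (Finset.mem_singleton_self k))
  have h2 := X.dist_triangle u k w
  change X.dist u w ≤ _
  omega

theorem LipschitzHomotopy.hasDisplacement {X : MetricSimplicialComplex V}
    {f Φ : X.Chains →ₗ[ℤ] X.Chains} {D : ℕ} (hD : X.LipschitzHomotopy LinearMap.id f Φ D) :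
    HasDisplacement X X Set.univ id (D + 1) Φ := by
  intro σ _ τ hτ u hu w hw
  refine (hD σ u (Or.inl (Or.inl ?_)) w (Or.inr ?_)).trans (Nat.le_succ D)
  · exact ⟨σ.1, ⟨σ, σ, subset_rfl, by simp, rfl⟩, hu⟩
  · exact ⟨τ.1, ⟨σ, τ, subset_rfl, hτ, rfl⟩, hw⟩

theorem support_single_subset_of_subset {X : MetricSimplicialComplex V} {S : Set V} {σ : X.faces}
    (hσ : (σ.1 : Set V) ⊆ S) :
    ∀ τ ∈ (Finsupp.single σ (1 : ℤ)).support, (τ.1 : Set V) ⊆ S := by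
  intro τ hτ
  rwa [Finset.mem_singleton.1 (Finsupp.support_single_subset hτ)]

theorem eq_zero_of_farFrom_univ {X : MetricSimplicialComplex V}
    {c : X.Chains} (h : X.FarFrom Set.univ 1 c) : c = 0 := by
  ext σ
  by_contra hσ
  obtain ⟨v, hv⟩ := nonempty_of_mem σ.2
  have := h σ (Finsupp.mem_support_iff.2 hσ) v hv v (Set.mem_univ v)
  rw [dist_self] at this
  omega

/-! ### Acyclicity -/

/-- The subcomplex of all simplices with vertices in `A`. -/
def fullSubcomplex (X : MetricSimplicialComplex V) (A : Set V) :
    PreAbstractSimplicialComplex V where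
  faces := {σ | σ ∈ X.faces ∧ (σ : Set V) ⊆ A}
  isRelLowerSet_faces := fun _ ⟨hσ, hA⟩ => ⟨nonempty_of_mem hσ, fun _ hρ hne =>
    ⟨mem_faces_of_subset hσ hρ hne, (Finset.coe_subset.2 hρ).trans hA⟩⟩

section Acyclic

variable [LinearOrder V] [LinearOrder W]

/-- The cycles of augmentation zero near a vertex bound near that vertex. -/
theorem exists_filling {Y : MetricSimplicialComplex W} (hY : Y.UniformlyAcyclic) (L : ℕ) :
    ∃ R, ∀ (y : W) (z : Y.Chains), Y.NearTo y L z → Y.boundary z = 0 → Y.augmentation z = 0 →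
      ∃ b, Y.boundary b = z ∧ Y.NearTo y R b := by
  obtain ⟨R₂, h⟩ := hY (2 * L)
  refine ⟨L + R₂, fun y z hz hz0 hz1 => ?_⟩
  -- Acyclicity is applied to the full subcomplex on the ball of radius `L` around `y`.
  have hdiam : Y.DiamLE {v | {v} ∈ (Y.fullSubcomplex {w | Y.dist y w ≤ L}).faces} (2 * L) := by
    rintro v ⟨-, hv⟩ w ⟨-, hw⟩
    have h1 : Y.dist y v ≤ L := hv (by simp)
    have h2 : Y.dist y w ≤ L := hw (by simp)
    have h3 := Y.dist_triangle v y w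
    have h4 := Y.dist_comm v y
    omega
  obtain ⟨b, hb, hbz⟩ := h (Y.fullSubcomplex {w | Y.dist y w ≤ L})
    (fun σ hσ => hσ.1) hdiam z (fun σ hσ => ⟨σ.2, hz σ hσ⟩) hz0 hz1
  refine ⟨b, hbz, fun τ hτ w hw => ?_⟩
  obtain ⟨k, hk, hkw⟩ := Y.exists_dist_le_of_mem_nbhd (hb τ hτ) hw
  have h1 : Y.dist y k ≤ L := hk.2 (by simp)
  have h2 := Y.dist_triangle y k w
  omega

/-- A finite chain lies in some ball, so uniform acyclicity implies acyclicity. -/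
theorem exists_boundary_eq {Y : MetricSimplicialComplex W} (hY : Y.UniformlyAcyclic)
    (z : Y.Chains) (hz : Y.boundary z = 0) (hz' : Y.augmentation z = 0) :
    ∃ b, Y.boundary b = z := by
  obtain ⟨y⟩ := Y.connected.nonempty
  have hfin : (⋃ τ ∈ z.support, ((τ.1 : Finset W) : Set W)).Finite :=
    z.support.finite_toSet.biUnion fun τ _ => τ.1.finite_toSet
  obtain ⟨L, hL⟩ := (hfin.image (Y.dist y)).bddAbove
  obtain ⟨R, hR⟩ := exists_filling hY L
  obtain ⟨b, hb, -⟩ := hR y z (fun τ hτ w hw => hL ⟨w, by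
    simp only [Set.mem_iUnion]
    exact ⟨τ, hτ, hw⟩, rfl⟩) hz hz'
  exact ⟨b, hb⟩

/-- A homogeneous version of `exists_filling`. -/
theorem exists_filling_card {Y : MetricSimplicialComplex W} (hY : Y.UniformlyAcyclic) (L : ℕ) :
    ∃ R, ∀ (y : W) (z : Y.Chains) (m : ℕ), Y.NearTo y L z → Y.boundary z = 0 →
      Y.augmentation z = 0 → (∀ τ ∈ z.support, τ.1.card + 1 = m) →
      ∃ b, Y.boundary b = z ∧ Y.NearTo y R b ∧ ∀ τ ∈ b.support, τ.1.card = m ∧ τ.1.card ≠ 1 := by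
  obtain ⟨R, hR⟩ := exists_filling hY L
  refine ⟨R, fun y z m hz hz0 hz1 hm => ?_⟩
  by_cases hm2 : 2 ≤ m
  · obtain ⟨b, hbz, hb⟩ := hR y z hz hz0 hz1
    obtain ⟨m, rfl⟩ := Nat.exists_eq_add_of_le' hm2
    refine ⟨b.filter fun τ => τ.1.card = m + 1 + 1, ?_, ?_, ?_⟩
    · rw [boundary_filter_card, hbz]
      rw [hbz]
      intro σ hσ
      have := hm σ hσ
      omega
    · intro τ hτ
      rw [Finsupp.support_filter, Finset.mem_filter] at hτ
      exact hb τ hτ.1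
    · intro τ hτ
      rw [Finsupp.support_filter, Finset.mem_filter] at hτ
      exact ⟨hτ.2, by omega⟩
  -- For `m ≤ 1` the chain `z` is zero, because simplices are nonempty.
  · refine ⟨0, ?_, fun τ hτ => by simp at hτ, fun τ hτ => by simp at hτ⟩
    rw [map_zero]
    ext τ
    by_contra h
    have h1 := hm τ (Finsupp.mem_support_iff.2 (Ne.symm h))
    have h2 := Finset.card_pos.2 (nonempty_of_mem τ.2)
    omega

/-- Solvability of `∂ T - ε T ∂ = f` by maps of bounded displacement, by induction over the
skeleta. -/
theorem exists_boundary_sub_boundary_eq {X : MetricSimplicialComplex V}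
    {Y : MetricSimplicialComplex W} (hY : Y.UniformlyAcyclic) {N : ℕ}
    (hN : ∀ σ ∈ X.faces, σ.card ≤ N) {S : Set V} {φ : V → W} {L₀ Lf : ℕ}
    (hφ : ∀ σ ∈ X.faces, (σ : Set V) ⊆ S → ∀ u ∈ σ, ∀ v ∈ σ, Y.dist (φ u) (φ v) ≤ L₀)
    (ε : ℤ) (e : ℕ) {f : X.Chains →ₗ[ℤ] Y.Chains} (hf : HasDisplacement X Y S φ Lf f)
    (hdeg : ∀ σ : X.faces, (σ.1 : Set V) ⊆ S → ∀ τ ∈ (f (Finsupp.single σ 1)).support,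
      τ.1.card + 1 = σ.1.card + e)
    (hbd : ∀ σ : X.faces, (σ.1 : Set V) ⊆ S →
      Y.boundary (f (Finsupp.single σ 1)) = -(ε • f (X.boundary (Finsupp.single σ 1))))
    (haug : ∀ σ : X.faces, (σ.1 : Set V) ⊆ S → Y.augmentation (f (Finsupp.single σ 1)) = 0) :
    ∃ (T : X.Chains →ₗ[ℤ] Y.Chains) (L : ℕ),
      (∀ σ : X.faces, ¬ (σ.1 : Set V) ⊆ S → T (Finsupp.single σ 1) = 0) ∧
      HasDisplacement X Y S φ L T ∧
      (∀ σ : X.faces, ∀ τ ∈ (T (Finsupp.single σ 1)).support,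
        τ.1.card = σ.1.card + e ∧ τ.1.card ≠ 1) ∧
      ∀ σ : X.faces, (σ.1 : Set V) ⊆ S → Y.boundary (T (Finsupp.single σ 1)) -
        ε • T (X.boundary (Finsupp.single σ 1)) = f (Finsupp.single σ 1) := by
  classical
  -- Induction on the number of vertices: `T` is constructed on simplices with at most `k` vertices.
  -- The displacement bound depends on `k`, but `k = N` suffices.
  suffices H : ∀ k : ℕ, ∃ (T : X.Chains →ₗ[ℤ] Y.Chains) (L : ℕ),
      (∀ σ : X.faces, ¬ ((σ.1 : Set V) ⊆ S ∧ σ.1.card ≤ k) → T (Finsupp.single σ 1) = 0) ∧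
      HasDisplacement X Y S φ L T ∧
      (∀ σ : X.faces, ∀ τ ∈ (T (Finsupp.single σ 1)).support,
        τ.1.card = σ.1.card + e ∧ τ.1.card ≠ 1) ∧
      ∀ σ : X.faces, (σ.1 : Set V) ⊆ S → σ.1.card ≤ k → Y.boundary (T (Finsupp.single σ 1)) -
        ε • T (X.boundary (Finsupp.single σ 1)) = f (Finsupp.single σ 1) by
    obtain ⟨T, L, h1, h2, h3, h4⟩ := H N
    exact ⟨T, L, fun σ hσ => h1 σ fun h => hσ h.1, h2, h3, fun σ hσ => h4 σ hσ (hN σ.1 σ.2)⟩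
  intro k
  induction k with
  | zero =>
    refine ⟨0, 0, fun _ _ => rfl, fun σ _ τ hτ => by simp at hτ, fun σ τ hτ => by simp at hτ, ?_⟩
    intro σ _ h
    have := Finset.card_pos.2 (nonempty_of_mem σ.2)
    omega
  | succ k ih =>
    obtain ⟨T, L, hT0, hTL, hTd, hT⟩ := ih
    -- The chain to be filled is `f σ + ε T(∂σ)`. The second term is controlled by `L` from vertices
    -- of faces of `σ`, and changing the base vertex within `σ` costs `L₀`.
    obtain ⟨R, hR⟩ := exists_filling_card hY (Lf + (L₀ + L))
    have key : ∀ σ : X.faces, ∃ b : Y.Chains,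
        ((σ.1 : Set V) ⊆ S → σ.1.card ≤ k + 1 → Y.boundary b =
          f (Finsupp.single σ 1) + ε • T (X.boundary (Finsupp.single σ 1))) ∧
        ((σ.1 : Set V) ⊆ S → ∃ u ∈ σ.1, Y.NearTo (φ u) R b) ∧
        ∀ τ ∈ b.support, τ.1.card = σ.1.card + e ∧ τ.1.card ≠ 1 := by
      intro σ
      by_cases hk : σ.1.card ≤ k + 1
      swap
      · exact ⟨0, fun _ h => (hk h).elim,
          fun _ => (nonempty_of_mem σ.2).imp fun u hu => ⟨hu, fun τ hτ => by simp at hτ⟩,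
          fun τ hτ => by simp at hτ⟩
      by_cases hσ : (σ.1 : Set V) ⊆ S
      swap
      · exact ⟨0, fun h => (hσ h).elim, fun h => (hσ h).elim, fun τ hτ => by simp at hτ⟩
      obtain ⟨u, hu⟩ := nonempty_of_mem σ.2
      have hface : ∀ ρ ∈ (X.boundary (Finsupp.single σ 1)).support, (ρ.1 : Set V) ⊆ S :=
        fun ρ hρ => (Finset.coe_subset.2 (X.subset_of_mem_support_boundary hρ)).trans hσ
      suffices hz : ∀ z, z = f (Finsupp.single σ 1) + ε • T (X.boundary (Finsupp.single σ 1)) →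
          Y.NearTo (φ u) (Lf + (L₀ + L)) z ∧ Y.boundary z = 0 ∧ Y.augmentation z = 0 ∧
          ∀ τ ∈ z.support, τ.1.card + 1 = σ.1.card + e by
        obtain ⟨hz1, hz2, hz3, hz4⟩ := hz _ rfl
        obtain ⟨b, hb1, hb2, hb3⟩ := hR (φ u) _ _ hz1 hz2 hz3 hz4
        exact ⟨b, fun _ _ => hb1, fun _ => ⟨u, hu, hb2⟩, hb3⟩
      rintro z rfl
      refine ⟨?_, ?_, ?_, ?_⟩
      · intro τ hτ w hw
        rcases Finset.mem_union.1 (Finsupp.support_add hτ) with hτ | hτ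
        · exact (hf σ hσ τ hτ u hu w hw).trans (by omega)
        · obtain ⟨ρ, hρ, hτρ⟩ :=
            Finsupp.exists_mem_support_of_mem_support_map T (Finsupp.support_smul hτ)
          obtain ⟨v, hv⟩ := nonempty_of_mem ρ.2
          have h1 := hTL ρ (hface ρ hρ) τ hτρ v hv w hw
          have h2 := hφ σ.1 σ.2 hσ u hu v (X.subset_of_mem_support_boundary hρ hv)
          have h3 := Y.dist_triangle (φ u) (φ v) w
          omega
      -- The inductive equation on the faces and `∂∂ = 0` give `∂T∂σ = f(∂σ)`, which `hbd` cancels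
      -- against `∂f σ`.
      · have h1 : Y.boundary (T (X.boundary (Finsupp.single σ 1))) -
            ε • T (X.boundary (X.boundary (Finsupp.single σ 1))) =
              f (X.boundary (Finsupp.single σ 1)) := by
          refine Finsupp.map_eq_of_forall_single (Y.boundary ∘ₗ T - ε • (T ∘ₗ X.boundary)) f
            fun ρ hρ => ?_
          have hc := X.card_of_mem_support_boundary hρ
          exact hT ρ (hface ρ hρ) (by omega)
        rw [boundary_boundary, map_zero, smul_zero, sub_zero] at h1
        rw [map_add, map_smul, h1, hbd σ hσ, neg_add_cancel]
      -- No vertex occurs in a value of `T`; the clause `τ.1.card ≠ 1` is carried through the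
      -- induction for this.
      · rw [map_add, map_smul, haug σ hσ, zero_add, augmentation_eq_zero, smul_zero]
        intro τ hτ
        obtain ⟨ρ, hρ, hτρ⟩ := Finsupp.exists_mem_support_of_mem_support_map T hτ
        exact (hTd ρ τ hτρ).2
      · intro τ hτ
        rcases Finset.mem_union.1 (Finsupp.support_add hτ) with hτ | hτ
        · exact hdeg σ hσ τ hτ
        · obtain ⟨ρ, hρ, hτρ⟩ :=
            Finsupp.exists_mem_support_of_mem_support_map T (Finsupp.support_smul hτ)
          have h1 := (hTd ρ τ hτρ).1
          have h2 := X.card_of_mem_support_boundary hρ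
          omega
    choose b hb1 hb2 hb3 using key
    set B : X.Chains →ₗ[ℤ] Y.Chains := Finsupp.linearCombination ℤ
      (fun σ : X.faces => if (σ.1 : Set V) ⊆ S ∧ σ.1.card = k + 1 then b σ else 0) with hB
    have hBs : ∀ σ : X.faces, B (Finsupp.single σ 1) =
        if (σ.1 : Set V) ⊆ S ∧ σ.1.card = k + 1 then b σ else 0 := fun σ => by simp [hB]
    have hsupp : ∀ σ τ, τ ∈ ((T + B) (Finsupp.single σ 1)).support →
        τ ∈ (T (Finsupp.single σ 1)).support ∨
          ((σ.1 : Set V) ⊆ S ∧ τ ∈ (b σ).support) := by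
      intro σ τ hτ
      rw [LinearMap.add_apply, hBs] at hτ
      rcases Finset.mem_union.1 (Finsupp.support_add hτ) with hτ | hτ
      · exact Or.inl hτ
      · split_ifs at hτ with h
        · exact Or.inr ⟨h.1, hτ⟩
        · simp at hτ
    have hBlow : ∀ σ : X.faces, σ.1.card ≤ k → B (Finsupp.single σ 1) = 0 := fun σ h => by
      rw [hBs, if_neg (by omega)]
    have hBbd : ∀ σ : X.faces, σ.1.card ≤ k + 1 → B (X.boundary (Finsupp.single σ 1)) = 0 :=
      fun σ hσ => Finsupp.map_eq_of_forall_single B 0 fun ρ hρ =>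
        hBlow ρ (by have := X.card_of_mem_support_boundary hρ; omega)
    refine ⟨T + B, max L (R + L₀), ?_, ?_, ?_, ?_⟩
    · intro σ hσ
      rw [LinearMap.add_apply, hT0 σ (fun h => hσ ⟨h.1, by omega⟩), hBs, if_neg, add_zero]
      exact fun h => hσ ⟨h.1, by omega⟩
    · intro σ hσ τ hτ u hu w hw
      rcases hsupp σ τ hτ with hτ | ⟨-, hτ⟩
      · exact (hTL σ hσ τ hτ u hu w hw).trans (le_max_left _ _)
      · obtain ⟨v, hv, hvb⟩ := hb2 σ hσ
        have h1 := hvb τ hτ w hw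
        have h2 := hφ σ.1 σ.2 hσ u hu v hv
        have h3 := Y.dist_triangle (φ u) (φ v) w
        exact le_max_of_le_right (by omega)
    · intro σ τ hτ
      rcases hsupp σ τ hτ with hτ | ⟨-, hτ⟩
      · exact hTd σ τ hτ
      · exact hb3 σ τ hτ
    · intro σ hσ hk
      rw [LinearMap.add_apply, LinearMap.add_apply, hBbd σ hk, add_zero, map_add]
      rcases Nat.lt_or_ge k σ.1.card with h | h
      · rw [hT0 σ (by omega), hBs, if_pos ⟨hσ, by omega⟩, hb1 σ hσ (by omega), map_zero]
        abel
      · rw [hBlow σ h, map_zero, add_zero, hT σ hσ h]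

/-- A vertex map that moves adjacent vertices to nearby vertices is covered by a chain map of
bounded displacement. -/
theorem exists_chainMap {X : MetricSimplicialComplex V}
    {Y : MetricSimplicialComplex W} (hY : Y.UniformlyAcyclic) {N : ℕ}
    (hN : ∀ σ ∈ X.faces, σ.card ≤ N) {S : Set V} {φ : V → W} {L₀ : ℕ}
    (hφ : ∀ σ ∈ X.faces, (σ : Set V) ⊆ S → ∀ u ∈ σ, ∀ v ∈ σ, Y.dist (φ u) (φ v) ≤ L₀) :
    ∃ (h : X.Chains →ₗ[ℤ] Y.Chains) (L : ℕ),
      (∀ σ : X.faces, ¬ (σ.1 : Set V) ⊆ S → h (Finsupp.single σ 1) = 0) ∧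
      HasDisplacement X Y S φ L h ∧
      (∀ σ : X.faces, ∀ τ ∈ (h (Finsupp.single σ 1)).support, τ.1.card = σ.1.card) ∧
      (∀ c : X.Chains, (∀ σ ∈ c.support, (σ.1 : Set V) ⊆ S) →
        Y.boundary (h c) = h (X.boundary c)) ∧
      ∀ c : X.Chains, (∀ σ ∈ c.support, (σ.1 : Set V) ⊆ S) →
        Y.augmentation (h c) = X.augmentation c := by
  classical
  set h₀ : X.Chains →ₗ[ℤ] Y.Chains := Finsupp.linearCombination ℤ
    (fun σ : X.faces => if (σ.1 : Set V) ⊆ S ∧ σ.1.card = 1 then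
      Y.vertexChain (φ (nonempty_of_mem σ.2).choose) else 0) with hh₀
  have h₀s : ∀ σ : X.faces, h₀ (Finsupp.single σ 1) =
      if (σ.1 : Set V) ⊆ S ∧ σ.1.card = 1 then
        Y.vertexChain (φ (nonempty_of_mem σ.2).choose) else 0 := fun σ => by simp [hh₀]
  have h₀supp : ∀ σ τ, τ ∈ (h₀ (Finsupp.single σ 1)).support →
      σ.1.card = 1 ∧ ∃ v ∈ σ.1, τ.1 = {φ v} := by
    intro σ τ hτ
    rw [h₀s] at hτ
    split_ifs at hτ with hσ
    · refine ⟨hσ.2, _, (nonempty_of_mem σ.2).choose_spec, ?_⟩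
      rw [vertexChain] at hτ
      rw [Finset.mem_singleton.1 (Finsupp.support_single_subset hτ)]
    · simp at hτ
  have h₀bd : ∀ c, Y.boundary (h₀ c) = 0 := by
    intro c
    rw [← LinearMap.comp_apply]
    refine Finsupp.map_eq_of_forall_single _ 0 fun σ _ => ?_
    rw [LinearMap.comp_apply, h₀s]
    split_ifs
    · exact Y.boundary_vertexChain _
    · exact map_zero _
  have h₀aug : ∀ c : X.Chains, (∀ σ ∈ c.support, (σ.1 : Set V) ⊆ S) →
      Y.augmentation (h₀ c) = X.augmentation c := by
    intro c hc
    rw [← LinearMap.comp_apply]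
    refine Finsupp.map_eq_of_forall_single _ _ fun σ hσ => ?_
    rw [LinearMap.comp_apply, h₀s]
    by_cases h1 : σ.1.card = 1
    · rw [if_pos ⟨hc σ hσ, h1⟩, augmentation_vertexChain]
      simp [augmentation, h1]
    · rw [if_neg fun h => h1 h.2]
      simp [augmentation, h1]
  have hface : ∀ σ : X.faces, (σ.1 : Set V) ⊆ S →
      ∀ ρ ∈ (X.boundary (Finsupp.single σ 1)).support, (ρ.1 : Set V) ⊆ S :=
    fun σ hσ ρ hρ => (Finset.coe_subset.2 (X.subset_of_mem_support_boundary hρ)).trans hσ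
  -- The map `h₀` is `φ` on vertices and zero on larger simplices, so `∂ h₀ = 0`. A solution of `∂T
  -- - T∂ = h₀ ∂` therefore makes `h₀ + T` a chain map.
  obtain ⟨T, L, hT0, hTL, hTd, hT⟩ := exists_boundary_sub_boundary_eq hY hN hφ 1 0
    (f := h₀ ∘ₗ X.boundary) (Lf := L₀)
    (by
      intro σ hσ τ hτ u hu w hw
      obtain ⟨ρ, hρ, hτρ⟩ := Finsupp.exists_mem_support_of_mem_support_map h₀ hτ
      obtain ⟨-, v, hv, hτv⟩ := h₀supp ρ τ hτρ
      rw [hτv, Finset.mem_singleton] at hw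
      rw [hw]
      exact hφ σ.1 σ.2 hσ u hu v (X.subset_of_mem_support_boundary hρ hv))
    (by
      intro σ hσ τ hτ
      obtain ⟨ρ, hρ, hτρ⟩ := Finsupp.exists_mem_support_of_mem_support_map h₀ hτ
      obtain ⟨h1, v, hv, hτv⟩ := h₀supp ρ τ hτρ
      rw [hτv, Finset.card_singleton, ← X.card_of_mem_support_boundary hρ, h1])
    (fun σ hσ => by
      rw [LinearMap.comp_apply, LinearMap.comp_apply, h₀bd, boundary_boundary]
      simp)
    (fun σ hσ => by
      rw [LinearMap.comp_apply, h₀aug _ (hface σ hσ), augmentation_boundary])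
  have hsupp : ∀ σ τ, τ ∈ ((h₀ + T) (Finsupp.single σ 1)).support →
      τ ∈ (h₀ (Finsupp.single σ 1)).support ∨ τ ∈ (T (Finsupp.single σ 1)).support := by
    intro σ τ hτ
    exact Finset.mem_union.1 (Finsupp.support_add hτ)
  refine ⟨h₀ + T, max L₀ L, ?_, ?_, ?_, ?_, ?_⟩
  · intro σ hσ
    rw [LinearMap.add_apply, hT0 σ hσ, h₀s, if_neg fun h => hσ h.1, add_zero]
  · intro σ hσ τ hτ u hu w hw
    rcases hsupp σ τ hτ with hτ | hτ
    · obtain ⟨-, v, hv, hτv⟩ := h₀supp σ τ hτ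
      rw [hτv, Finset.mem_singleton] at hw
      rw [hw]
      exact le_max_of_le_left (hφ σ.1 σ.2 hσ u hu v hv)
    · exact le_max_of_le_right (hTL σ hσ τ hτ u hu w hw)
  · intro σ τ hτ
    rcases hsupp σ τ hτ with hτ | hτ
    · obtain ⟨h1, v, hv, hτv⟩ := h₀supp σ τ hτ
      rw [hτv, Finset.card_singleton, h1]
    · exact (hTd σ τ hτ).1
  · intro c hc
    refine Finsupp.map_eq_of_forall_single (Y.boundary ∘ₗ (h₀ + T)) ((h₀ + T) ∘ₗ X.boundary)
      fun σ hσ => ?_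
    have h1 := hT σ (hc σ hσ)
    rw [one_smul, LinearMap.comp_apply, sub_eq_iff_eq_add] at h1
    rw [LinearMap.comp_apply, LinearMap.comp_apply, LinearMap.add_apply, LinearMap.add_apply,
      map_add, h₀bd, zero_add, h1]
  · intro c hc
    rw [LinearMap.add_apply, map_add, h₀aug c hc, augmentation_eq_zero _ (c := T c), add_zero]
    intro τ hτ
    obtain ⟨σ, -, hτσ⟩ := Finsupp.exists_mem_support_of_mem_support_map T hτ
    exact (hTd σ τ hτσ).2

/-- A chain map of bounded displacement that vanishes under the augmentation is null-homotopic by a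
homotopy of bounded displacement. -/
theorem exists_nullhomotopy {X : MetricSimplicialComplex V}
    {Y : MetricSimplicialComplex W} (hY : Y.UniformlyAcyclic) {N : ℕ}
    (hN : ∀ σ ∈ X.faces, σ.card ≤ N) {S : Set V} {φ : V → W} {L₀ Lf : ℕ}
    (hφ : ∀ σ ∈ X.faces, (σ : Set V) ⊆ S → ∀ u ∈ σ, ∀ v ∈ σ, Y.dist (φ u) (φ v) ≤ L₀)
    {f : X.Chains →ₗ[ℤ] Y.Chains} (hf : HasDisplacement X Y S φ Lf f)
    (hdeg : ∀ σ : X.faces, (σ.1 : Set V) ⊆ S → ∀ τ ∈ (f (Finsupp.single σ 1)).support,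
      τ.1.card = σ.1.card)
    (hbd : ∀ σ : X.faces, (σ.1 : Set V) ⊆ S →
      Y.boundary (f (Finsupp.single σ 1)) = f (X.boundary (Finsupp.single σ 1)))
    (haug : ∀ σ : X.faces, (σ.1 : Set V) ⊆ S → Y.augmentation (f (Finsupp.single σ 1)) = 0) :
    ∃ (H : X.Chains →ₗ[ℤ] Y.Chains) (L : ℕ),
      (∀ σ : X.faces, ¬ (σ.1 : Set V) ⊆ S → H (Finsupp.single σ 1) = 0) ∧
      HasDisplacement X Y S φ L H ∧
      ∀ σ : X.faces, (σ.1 : Set V) ⊆ S → Y.boundary (H (Finsupp.single σ 1)) +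
        H (X.boundary (Finsupp.single σ 1)) = f (Finsupp.single σ 1) := by
  -- With `ε = -1` and degree shift one the equation is that of a null-homotopy.
  obtain ⟨H, L, h1, h2, -, h4⟩ := exists_boundary_sub_boundary_eq hY hN hφ (-1) 1 hf
    (fun σ hσ τ hτ => by rw [hdeg σ hσ τ hτ]) (fun σ hσ => by rw [hbd σ hσ]; simp) haug
  exact ⟨H, L, h1, h2, fun σ hσ => by simpa using h4 σ hσ⟩

end Acyclic

end MetricSimplicialComplex

namespace MetricSimplicialComplex

variable {V V' W : Type*} [LinearOrder V] [LinearOrder V'] [LinearOrder W]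

/-! ### Duality data -/

/-- The maps and homotopies of a coarse Poincaré duality space of formal dimension `n`. -/
structure DualityData (X : MetricSimplicialComplex V) (n : ℤ) where
  /-- a common bound on the displacements -/
  D : ℕ
  /-- the duality map from chains to cochains -/
  Pbar : X.Chains →ₗ[ℤ] X.Cochains
  /-- the duality map from cochains to chains -/
  P : X.Cochains →ₗ[ℤ] X.Chains
  /-- the homotopy from the identity to `P ∘ Pbar` -/
  Phi : X.Chains →ₗ[ℤ] X.Chains
  /-- the homotopy from the identity to `Pbar ∘ P` -/
  Phibar : X.Cochains →ₗ[ℤ] X.Cochains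
  card_Pbar : ∀ σ, ∀ τ ∈ (Pbar (Finsupp.single σ 1)).support, (σ.1.card + τ.1.card : ℤ) = n + 2
  card_P : ∀ σ, ∀ τ ∈ (P (Finsupp.single σ 1)).support, (σ.1.card + τ.1.card : ℤ) = n + 2
  coboundary_Pbar : ∀ c, X.coboundary (Pbar c) = Pbar (X.boundary c)
  boundary_P : ∀ α, X.boundary (P α) = P (X.coboundary α)
  homotopy : ∀ c, X.boundary (Phi c) + Phi (X.boundary c) = P (Pbar c) - c
  cohomotopy : ∀ α, X.coboundary (Phibar α) + Phibar (X.coboundary α) = Pbar (P α) - α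
  displacement_Pbar : HasDisplacement X X Set.univ id D Pbar
  displacement_P : HasDisplacement X X Set.univ id D P
  displacement_Phi : HasDisplacement X X Set.univ id D Phi
  displacement_Phibar : HasDisplacement X X Set.univ id D Phibar

theorem IsCoarsePD.exists_dualityData {X : MetricSimplicialComplex V} {n : ℤ}
    (hX : X.IsCoarsePD n) : Nonempty (X.DualityData n) := by
  obtain ⟨-, -, D, Pbar, P, h1, h2, h3, h4, h5, h6, ⟨Φ, -, h8, h9⟩, Φbar, -, h11, h12⟩ := hX
  -- Cardinalities exceed dimensions by one, so complementary dimensions `n` become a total of `n +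
  -- 2` vertices.
  refine ⟨⟨D + 1, Pbar, P, Φ, Φbar, fun σ τ hτ => ?_, fun σ τ hτ => ?_, h3, h4, h8, h11,
    h5.hasDisplacement, h6.hasDisplacement, h9.hasDisplacement, h12.hasDisplacement⟩⟩
  · have := h1 σ τ hτ
    simp only [dim] at this
    omega
  · have := h2 σ τ hτ
    simp only [dim] at this
    omega

/-! ### Chain maps over vertex maps -/

/-- A chain map of bounded displacement, defined on the simplices with vertices in `S` and covering
the vertex map `φ`. -/
structure ChainLift (X : MetricSimplicialComplex V) (Y : MetricSimplicialComplex W) (S : Set V)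
    (φ : V → W) where
  /-- the underlying map, which vanishes on simplices not contained in `S` -/
  map : X.Chains →ₗ[ℤ] Y.Chains
  /-- a bound on the displacement -/
  L : ℕ
  map_single : ∀ σ : X.faces, ¬ (σ.1 : Set V) ⊆ S → map (Finsupp.single σ 1) = 0
  displacement : HasDisplacement X Y S φ L map
  card_map : ∀ σ : X.faces, ∀ τ ∈ (map (Finsupp.single σ 1)).support, τ.1.card = σ.1.card
  boundary_map : ∀ c : X.Chains, (∀ σ ∈ c.support, (σ.1 : Set V) ⊆ S) →
    Y.boundary (map c) = map (X.boundary c)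
  augmentation_map : ∀ c : X.Chains, (∀ σ ∈ c.support, (σ.1 : Set V) ⊆ S) →
    Y.augmentation (map c) = X.augmentation c

/-- The lift commutes with boundaries only on chains in `S`, so its transpose commutes with
coboundaries only when evaluated on simplices in `S`. -/
theorem ChainLift.coboundary_transpose_apply {X : MetricSimplicialComplex V}
    {Y : MetricSimplicialComplex W} {S : Set V} {φ : V → W} (h : ChainLift X Y S φ)
    (hp : Finsupp.IsProper h.map) (α : Y.Cochains) {σ : X.faces} (hσ : (σ.1 : Set V) ⊆ S) :
    X.coboundary (Finsupp.transpose h.map hp α) σ =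
      Finsupp.pairing (Y.coboundary α) (h.map (Finsupp.single σ 1)) := by
  rw [coboundary_apply, Finsupp.pairing_transpose, pairing_coboundary,
    h.boundary_map _ (support_single_subset_of_subset hσ)]

theorem ChainLift.coboundary_transpose {X : MetricSimplicialComplex V}
    {Y : MetricSimplicialComplex W} {φ : V → W} (h : ChainLift X Y Set.univ φ)
    (hp : Finsupp.IsProper h.map) (α : Y.Cochains) :
    X.coboundary (Finsupp.transpose h.map hp α) = Finsupp.transpose h.map hp (Y.coboundary α) := by
  ext σ
  rw [h.coboundary_transpose_apply hp α (Set.subset_univ _), Finsupp.transpose_apply]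

/-- The data of a uniformly proper simplicial map `g` from a coarse Poincaré duality space of
formal dimension `n - 1` to one of formal dimension `n`. -/
structure JordanData (X : MetricSimplicialComplex V) (X' : MetricSimplicialComplex V') (n : ℤ)
    (g : V' → V) where
  acyclic : X.UniformlyAcyclic
  acyclic' : X'.UniformlyAcyclic
  /-- a bound on the cardinality of the simplices of `X` -/
  N : ℕ
  /-- a bound on the cardinality of the simplices of `X'` -/
  N' : ℕ
  card_le : ∀ σ ∈ X.faces, σ.card ≤ N
  card_le' : ∀ σ ∈ X'.faces, σ.card ≤ N'
  /-- the duality maps of `X` -/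
  d : X.DualityData n
  /-- the duality maps of `X'` -/
  d' : X'.DualityData (n - 1)
  /-- a bound on distances in `X'` in terms of distances of images -/
  ρ : ℕ → ℕ
  dist_le_ρ : ∀ t v w, X.dist (g v) (g w) ≤ t → X'.dist v w ≤ ρ t
  dist_map : ∀ v w, X.dist (g v) (g w) ≤ X'.dist v w
  /-- a chain map covering `g` -/
  G : ChainLift X' X Set.univ g

theorem exists_chainLift {X : MetricSimplicialComplex V}
    {Y : MetricSimplicialComplex W} (hY : Y.UniformlyAcyclic) {N : ℕ}
    (hN : ∀ σ ∈ X.faces, σ.card ≤ N) {S : Set V} {φ : V → W} {L₀ : ℕ}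
    (hφ : ∀ σ ∈ X.faces, (σ : Set V) ⊆ S → ∀ u ∈ σ, ∀ v ∈ σ, Y.dist (φ u) (φ v) ≤ L₀) :
    Nonempty (ChainLift X Y S φ) := by
  obtain ⟨h, L, h1, h2, h3, h4, h5⟩ := exists_chainMap hY hN hφ
  exact ⟨⟨h, L, h1, h2, h3, h4, h5⟩⟩

theorem IsCoarsePD.exists_jordanData {X : MetricSimplicialComplex V}
    {X' : MetricSimplicialComplex V'} {n : ℤ} (hX : X.IsCoarsePD n) (hX' : X'.IsCoarsePD (n - 1))
    {g : V' → V} (hg : IsSimplicialMap X' X g) (hgp : IsUniformlyProper X' X g) :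
    Nonempty (JordanData X X' n g) := by
  obtain ⟨N, hN⟩ := exists_card_le hX.1
  obtain ⟨N', hN'⟩ := exists_card_le hX'.1
  obtain ⟨ρ, hρ⟩ := exists_dist_le_of_uniformlyProper hgp
  obtain ⟨G⟩ := exists_chainLift (S := Set.univ) (φ := g) (L₀ := 1) hX.2.1 hN'
    fun σ hσ _ u hu v hv => (dist_map_le hg u v).trans (X'.dist_le_one hσ hu hv)
  obtain ⟨d⟩ := hX.exists_dualityData
  obtain ⟨d'⟩ := hX'.exists_dualityData
  exact ⟨⟨hX.2.1, hX'.2.1, N, N', hN, hN', d, d', ρ, hρ, dist_map_le hg, G⟩⟩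

/-! ### Pullback along `g` and coarse retractions to `X'` -/

namespace JordanData

variable {X : MetricSimplicialComplex V} {X' : MetricSimplicialComplex V'} {n : ℤ} {g : V' → V}

/-- Uniform properness makes preimages of balls bounded, hence finite; this is what allows compactly
supported cochains to be pulled back. -/
theorem isProper_G (J : JordanData X X' n g) : Finsupp.IsProper J.G.map := by
  refine isProper_of_hasDisplacement J.G.displacement J.G.map_single fun w => ?_
  rcases Set.eq_empty_or_nonempty {u | u ∈ Set.univ ∧ X.dist (g u) w ≤ J.G.L} with h | ⟨u, -, hu⟩
  · rw [h]
    exact Set.finite_empty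
  · refine (X'.finite_ball u (J.ρ (J.G.L + J.G.L))).subset fun v hv => J.dist_le_ρ _ _ _ ?_
    have h1 := X.dist_triangle (g u) w (g v)
    have h2 := X.dist_comm (g v) w
    have h3 : X.dist (g v) w ≤ J.G.L := hv.2
    omega

/-- The pullback of cochains under `g`. -/
noncomputable def pullback (J : JordanData X X' n g) : X.Cochains →ₗ[ℤ] X'.Cochains :=
  Finsupp.transpose J.G.map J.isProper_G

theorem pairing_pullback (J : JordanData X X' n g) (α : X.Cochains) (c : X'.Chains) :
    Finsupp.pairing (J.pullback α) c = Finsupp.pairing α (J.G.map c) :=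
  Finsupp.pairing_transpose _ _ _ _

theorem coboundary_pullback (J : JordanData X X' n g) (α : X.Cochains) :
    X'.coboundary (J.pullback α) = J.pullback (X.coboundary α) :=
  J.G.coboundary_transpose _ α

theorem farFrom_pullback (J : JordanData X X' n g) {Z : Set V'} {r : ℕ} {α : X.Cochains}
    (h : X.FarFrom (g '' Z) (r + J.G.L) α) : X'.FarFrom Z r (J.pullback α) := by
  intro σ hσ u hu z hz
  obtain ⟨τ, hτ, hτσ⟩ := Finsupp.exists_mem_support_of_transpose _ _ hσ
  obtain ⟨w, hw⟩ := nonempty_of_mem τ.2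
  have h1 := h τ hτ w hw (g z) (Set.mem_image_of_mem g hz)
  have h2 := J.G.displacement σ (Set.subset_univ _) τ hτσ u hu w hw
  have h3 := X.dist_triangle (g z) (g u) w
  have h4 := J.dist_map z u
  omega

theorem pullback_eq_zero (J : JordanData X X' n g) {α : X.Cochains}
    (h : X.FarFrom (g '' Set.univ) (1 + J.G.L) α) : J.pullback α = 0 :=
  eq_zero_of_farFrom_univ (J.farFrom_pullback h)

/-- A coarse retraction of the `s`-neighbourhood of the image of `g` to `X'`. -/
structure Retraction (J : JordanData X X' n g) (s : ℕ) where
  /-- the vertex map -/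
  φ : V → V'
  dist_φ : ∀ u v, X.dist (g v) u ≤ s → X.dist (g (φ u)) u ≤ s
  /-- the chain map -/
  h : ChainLift X X' {u | ∃ v, X.dist (g v) u ≤ s} φ

theorem exists_retraction (J : JordanData X X' n g) (s : ℕ) : Nonempty (J.Retraction s) := by
  classical
  obtain ⟨v₀⟩ := X'.connected.nonempty
  set φ : V → V' := fun u => if h : ∃ v, X.dist (g v) u ≤ s then h.choose else v₀ with hφ
  have h1 : ∀ u v, X.dist (g v) u ≤ s → X.dist (g (φ u)) u ≤ s := by
    intro u v h
    have h' : ∃ v, X.dist (g v) u ≤ s := ⟨v, h⟩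
    rw [hφ]
    dsimp only
    rw [dif_pos h']
    exact h'.choose_spec
  obtain ⟨h⟩ := exists_chainLift (S := {u | ∃ v, X.dist (g v) u ≤ s}) (φ := φ)
    -- Adjacent vertices `u`, `v` have `g (φ u)` and `g (φ v)` within `s + 1 + s`; `ρ` turns this
    -- into a bound in `X'`.
    (L₀ := J.ρ (s + 1 + s)) J.acyclic' J.card_le (by
      intro σ hσ hS u hu v hv
      obtain ⟨u', hu'⟩ := hS hu
      obtain ⟨v', hv'⟩ := hS hv
      refine J.dist_le_ρ _ _ _ ?_
      have h2 := h1 u u' hu'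
      have h3 := h1 v v' hv'
      have h4 := X.dist_le_one hσ hu hv
      have h5 := X.dist_triangle (g (φ u)) u (g (φ v))
      have h6 := X.dist_triangle u v (g (φ v))
      have h7 := X.dist_comm v (g (φ v))
      omega)
  exact ⟨⟨φ, h1, h⟩⟩

namespace Retraction

variable {J : JordanData X X' n g} {s : ℕ}

theorem isProper (h : J.Retraction s) : Finsupp.IsProper h.h.map := by
  refine isProper_of_hasDisplacement h.h.displacement h.h.map_single fun w => ?_
  refine (X.finite_ball (g w) (h.h.L + s)).subset ?_
  rintro u ⟨⟨v, hv⟩, hu⟩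
  have h1 := h.dist_φ u v hv
  have h2 := J.dist_map (h.φ u) w
  have h3 := X.dist_triangle (g w) (g (h.φ u)) u
  have h4 := X.dist_comm (g w) (g (h.φ u))
  change X.dist (g w) u ≤ _
  omega

/-- On the `s`-neighbourhood both `G ∘ h` and the identity move simplices a bounded amount and
preserve the augmentation, so their difference is null-homotopic by acyclicity of `X`. -/
theorem exists_homotopy (h : J.Retraction s) :
    ∃ (H : X.Chains →ₗ[ℤ] X.Chains) (L : ℕ), Finsupp.IsProper H ∧
      HasDisplacement X X {u | ∃ v, X.dist (g v) u ≤ s} id L H ∧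
      ∀ σ : X.faces, (σ.1 : Set V) ⊆ {u | ∃ v, X.dist (g v) u ≤ s} →
        X.boundary (H (Finsupp.single σ 1)) + H (X.boundary (Finsupp.single σ 1)) =
          J.G.map (h.h.map (Finsupp.single σ 1)) - Finsupp.single σ 1 := by
  have hsupp : ∀ σ τ : X.faces, τ ∈ ((J.G.map ∘ₗ h.h.map - LinearMap.id :
      X.Chains →ₗ[ℤ] X.Chains) (Finsupp.single σ 1)).support → τ = σ ∨
      ∃ ρ ∈ (h.h.map (Finsupp.single σ 1)).support,
        τ ∈ (J.G.map (Finsupp.single ρ 1)).support := by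
    intro σ τ hτ
    rcases Finset.mem_union.1 (Finsupp.support_sub hτ) with hτ | hτ
    · exact Or.inr (Finsupp.exists_mem_support_of_mem_support_map J.G.map hτ)
    · exact Or.inl (Finset.mem_singleton.1 (Finsupp.support_single_subset hτ))
  obtain ⟨H, L, h1, h2, h3⟩ := exists_nullhomotopy (X := X) (Y := X) J.acyclic J.card_le
    (S := {u | ∃ v, X.dist (g v) u ≤ s}) (φ := id)
    (L₀ := 1) (Lf := s + h.h.L + J.G.L + 1) (f := J.G.map ∘ₗ h.h.map - LinearMap.id)
    (fun σ hσ _ u hu v hv => X.dist_le_one hσ hu hv)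
    (by
      intro σ hσ τ hτ u hu w hw
      change X.dist u w ≤ _
      rcases hsupp σ τ hτ with rfl | ⟨ρ, hρ, hτρ⟩
      · have := X.dist_le_one τ.2 hu hw
        omega
      · obtain ⟨x, hx⟩ := nonempty_of_mem ρ.2
        obtain ⟨v, hv⟩ := hσ hu
        have h1 := h.dist_φ u v hv
        have h2 := h.h.displacement σ hσ ρ hρ u hu x hx
        have h3 := J.G.displacement ρ (Set.subset_univ _) τ hτρ x hx w hw
        have h4 := J.dist_map (h.φ u) x
        have h5 := X.dist_triangle u (g (h.φ u)) w
        have h6 := X.dist_triangle (g (h.φ u)) (g x) w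
        have h7 := X.dist_comm u (g (h.φ u))
        omega)
    (by
      intro σ hσ τ hτ
      rcases hsupp σ τ hτ with rfl | ⟨ρ, hρ, hτρ⟩
      · rfl
      · rw [J.G.card_map ρ τ hτρ, h.h.card_map σ ρ hρ])
    (by
      intro σ hσ
      simp only [LinearMap.sub_apply, LinearMap.comp_apply, LinearMap.id_apply, map_sub]
      rw [J.G.boundary_map _ fun _ _ => Set.subset_univ _,
        h.h.boundary_map _ (support_single_subset_of_subset hσ)])
    (by
      intro σ hσ
      simp only [LinearMap.sub_apply, LinearMap.comp_apply, LinearMap.id_apply, map_sub]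
      rw [J.G.augmentation_map _ fun _ _ => Set.subset_univ _,
        h.h.augmentation_map _ (support_single_subset_of_subset hσ), sub_self])
  refine ⟨H, L, isProper_of_hasDisplacement h2 h1 fun w => ?_, h2, h3⟩
  refine (X.finite_ball w L).subset fun u hu => ?_
  exact (X.dist_comm w u).le.trans hu.2

/-- The condition `hs` places the image of `G` in the domain of `h`. Since `g (φ x)` is close to
`x`, uniform properness bounds the displacement of `h ∘ G` in `X'`. -/
theorem exists_homotopy' (h : J.Retraction s) (hs : J.G.L ≤ s) :
    ∃ (H : X'.Chains →ₗ[ℤ] X'.Chains), Finsupp.IsProper H ∧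
      ∀ σ : X'.faces,
        X'.boundary (H (Finsupp.single σ 1)) + H (X'.boundary (Finsupp.single σ 1)) =
          h.h.map (J.G.map (Finsupp.single σ 1)) - Finsupp.single σ 1 := by
  have hS : ∀ σ : X'.faces, ∀ ρ ∈ (J.G.map (Finsupp.single σ 1)).support,
      (ρ.1 : Set V) ⊆ {u | ∃ v, X.dist (g v) u ≤ s} := by
    intro σ ρ hρ w hw
    obtain ⟨u, hu⟩ := nonempty_of_mem σ.2
    exact ⟨u, (J.G.displacement σ (Set.subset_univ _) ρ hρ u hu w hw).trans hs⟩
  have hsupp : ∀ σ τ : X'.faces, τ ∈ ((h.h.map ∘ₗ J.G.map - LinearMap.id :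
      X'.Chains →ₗ[ℤ] X'.Chains) (Finsupp.single σ 1)).support → τ = σ ∨
      ∃ ρ ∈ (J.G.map (Finsupp.single σ 1)).support,
        τ ∈ (h.h.map (Finsupp.single ρ 1)).support := by
    intro σ τ hτ
    rcases Finset.mem_union.1 (Finsupp.support_sub hτ) with hτ | hτ
    · exact Or.inr (Finsupp.exists_mem_support_of_mem_support_map h.h.map hτ)
    · exact Or.inl (Finset.mem_singleton.1 (Finsupp.support_single_subset hτ))
  obtain ⟨H, L, h1, h2, h3⟩ := exists_nullhomotopy (X := X') (Y := X') J.acyclic' J.card_le'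
    (S := Set.univ) (φ := id) (L₀ := 1) (Lf := J.ρ (J.G.L + s) + h.h.L + 1)
    (f := h.h.map ∘ₗ J.G.map - LinearMap.id)
    (fun σ hσ _ u hu v hv => X'.dist_le_one hσ hu hv)
    (by
      intro σ _ τ hτ u hu w hw
      change X'.dist u w ≤ _
      rcases hsupp σ τ hτ with rfl | ⟨ρ, hρ, hτρ⟩
      · have := X'.dist_le_one τ.2 hu hw
        omega
      · obtain ⟨x, hx⟩ := nonempty_of_mem ρ.2
        have h1 := J.G.displacement σ (Set.subset_univ _) ρ hρ u hu x hx
        have h2 := h.h.displacement ρ (hS σ ρ hρ) τ hτρ x hx w hw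
        have h3 := h.dist_φ x u (h1.trans hs)
        have h4 := X.dist_triangle (g u) x (g (h.φ x))
        have h5 := X.dist_comm x (g (h.φ x))
        have h6 := J.dist_le_ρ (J.G.L + s) u (h.φ x) (by omega)
        have h7 := X'.dist_triangle u (h.φ x) w
        omega)
    (by
      intro σ _ τ hτ
      rcases hsupp σ τ hτ with rfl | ⟨ρ, hρ, hτρ⟩
      · rfl
      · rw [h.h.card_map ρ τ hτρ, J.G.card_map σ ρ hρ])
    (by
      intro σ _
      simp only [LinearMap.sub_apply, LinearMap.comp_apply, LinearMap.id_apply, map_sub]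
      rw [h.h.boundary_map _ (hS σ), J.G.boundary_map _ fun _ _ => Set.subset_univ _])
    (by
      intro σ _
      simp only [LinearMap.sub_apply, LinearMap.comp_apply, LinearMap.id_apply, map_sub]
      rw [h.h.augmentation_map _ (hS σ), J.G.augmentation_map _ fun _ _ => Set.subset_univ _,
        sub_self])
  refine ⟨H, isProper_of_hasDisplacement h2 h1 fun w => ?_, fun σ => h3 σ (Set.subset_univ _)⟩
  refine (X'.finite_ball w L).subset fun u hu => ?_
  exact (X'.dist_comm w u).le.trans hu.2

end Retraction

end JordanData

end MetricSimplicialComplex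

/-! ### Duality relative to `g(X')` and linking numbers -/

namespace MetricSimplicialComplex

variable {V V' : Type*} [LinearOrder V] [LinearOrder V']

namespace JordanData

variable {X : MetricSimplicialComplex V} {X' : MetricSimplicialComplex V'} {n : ℤ} {g : V' → V}

/-- If the pulled back dual of a relative cycle `c` is a coboundary near `Z`, then `∂ c` bounds far
from `g(Z)`. -/
theorem exists_farFrom_of_coboundary (J : JordanData X X' n g) (s : ℕ) :
    ∃ r t : ℕ, ∀ (Z : Set V') (c : X.Chains) (β : X'.Cochains),
      X.FarFrom (g '' Z) r (X.boundary c) →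
      X'.FarFrom Z t (J.pullback (J.d.Pbar c) - X'.coboundary β) →
      ∃ c', X.FarFrom (g '' Z) s c' ∧ X.boundary c' = X.boundary c := by
  obtain ⟨h⟩ := J.exists_retraction (s + J.d.D)
  obtain ⟨H, L, hHp, hHL, hH⟩ := h.exists_homotopy
  -- The coboundary of `Pbar c` must remain out of reach of `H` on the `(s + D)`-neighbourhood,
  -- which costs `L`; `Pbar` itself costs `D`. The second constant exceeds the distance from `Z` of
  -- the image under `h` of any simplex near `g(Z)`.
  refine ⟨s + J.d.D + L + 1 + J.d.D, J.ρ (s + J.d.D + (s + J.d.D)) + h.h.L + 1,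
    fun Z c β hc hβ => ?_⟩
  set α := J.d.Pbar c with hα
  set γ := Finsupp.transpose h.h.map h.isProper β - Finsupp.transpose H hHp α with hγ
  have hδα : X.FarFrom (g '' Z) (s + J.d.D + L + 1) (X.coboundary α) := by
    rw [hα, J.d.coboundary_Pbar]
    exact hc.map J.d.displacement_Pbar
  -- For `σ` near `g(Z)`: `δ(hᵀβ)(σ) = ⟨g^*α, hσ⟩ = ⟨α, Ghσ⟩ = α(σ) + ⟨δα, Hσ⟩ + δ(Hᵀα)(σ)`, and the
  -- middle term vanishes because `δα` is far away.
  have key : X.FarFrom (g '' Z) (s + J.d.D) (α - X.coboundary γ) := by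
    rintro σ hσ w hw _ ⟨z, hz, rfl⟩
    by_contra hlt
    have hnear : ∀ u ∈ σ.1, X.dist (g z) u ≤ s + J.d.D := by
      intro u hu
      have h1 := X.dist_le_one σ.2 hw hu
      have h2 := X.dist_triangle (g z) w u
      omega
    have hσS : (σ.1 : Set V) ⊆ {u | ∃ v, X.dist (g v) u ≤ s + J.d.D} :=
      fun u hu => ⟨z, hnear u hu⟩
    obtain ⟨u, hu⟩ := nonempty_of_mem σ.2
    have h1 : Finsupp.pairing (X'.coboundary β) (h.h.map (Finsupp.single σ 1)) =
        Finsupp.pairing (J.pullback α) (h.h.map (Finsupp.single σ 1)) := by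
      refine Finsupp.pairing_congr fun τ hτ => ?_
      by_contra hne
      obtain ⟨x, hx⟩ := nonempty_of_mem τ.2
      have h2 := hβ τ (Finsupp.mem_support_iff.2 (by
        rw [Finsupp.sub_apply]; exact sub_ne_zero.2 (Ne.symm hne))) x hx z hz
      have h3 := h.h.displacement σ hσS τ hτ u hu x hx
      have h4 := h.dist_φ u z (hnear u hu)
      have h5 := X.dist_triangle (g z) u (g (h.φ u))
      have h6 := X.dist_comm u (g (h.φ u))
      have h7 := hnear u hu
      have h8 := J.dist_le_ρ (s + J.d.D + (s + J.d.D)) z (h.φ u) (by omega)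
      have h9 := X'.dist_triangle z (h.φ u) x
      omega
    have h2 : Finsupp.pairing (X.coboundary α) (H (Finsupp.single σ 1)) = 0 := by
      refine Finsupp.pairing_eq_zero fun τ hτ => ?_
      by_contra hne
      obtain ⟨x, hx⟩ := nonempty_of_mem τ.2
      have h3 := hδα τ (Finsupp.mem_support_iff.2 hne) x hx (g z) (Set.mem_image_of_mem g hz)
      have h4 : X.dist u x ≤ L := hHL σ hσS τ hτ u hu x hx
      have h5 := hnear u hu
      have h6 := X.dist_triangle (g z) u x
      omega
    refine Finsupp.mem_support_iff.1 hσ ?_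
    rw [Finsupp.sub_apply, hγ, map_sub, Finsupp.sub_apply, h.h.coboundary_transpose_apply _ _ hσS,
      h1, coboundary_apply, Finsupp.pairing_transpose, J.pairing_pullback,
      eq_add_of_sub_eq (hH σ hσS).symm, map_add, map_add, ← pairing_coboundary, h2,
      Finsupp.pairing_single]
    ring
  -- The boundary of the first term is `P Pbar ∂c`; the homotopy `Phi` corrects it to `∂c`.
  refine ⟨J.d.P (α - X.coboundary γ) - J.d.Phi (X.boundary c),
    (key.map J.d.displacement_P).sub ((hc.mono (by omega)).map J.d.displacement_Phi), ?_⟩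
  have h1 := J.d.homotopy (X.boundary c)
  rw [boundary_boundary, map_zero, add_zero] at h1
  rw [map_sub, J.d.boundary_P, map_sub, coboundary_coboundary, sub_zero, hα, J.d.coboundary_Pbar,
    h1]
  abel

/-- The linking number of `g(X')` with a chain whose boundary is far from `g(X')`. -/
noncomputable def linking (J : JordanData X X' n g) : X.Chains →ₗ[ℤ] ℤ :=
  X'.augmentation ∘ₗ J.d'.P ∘ₗ J.pullback ∘ₗ J.d.Pbar

theorem linking_apply (J : JordanData X X' n g) (c : X.Chains) :
    J.linking c = X'.augmentation (J.d'.P (J.pullback (J.d.Pbar c))) := rfl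

/-- All the maps composed in `linking` commute with the (co)boundaries, and the augmentation kills
boundaries. -/
theorem linking_boundary (J : JordanData X X' n g) (c : X.Chains) :
    J.linking (X.boundary c) = 0 := by
  rw [linking_apply, ← J.d.coboundary_Pbar, ← J.coboundary_pullback, ← J.d'.boundary_P,
    augmentation_boundary]

theorem linking_eq_zero (J : JordanData X X' n g) {c : X.Chains}
    (h : X.FarFrom (g '' Set.univ) (1 + J.G.L + J.d.D) c) : J.linking c = 0 := by
  rw [linking_apply, J.pullback_eq_zero (h.map J.d.displacement_Pbar), map_zero, map_zero]

/-- The pullback `α` of `Pbar c` is a cocycle because `∂c` is far away. Zero linking number makes `P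
α` a boundary `∂e` in `X'`, and then `α = δ(Pbar e - Phibar α)`. -/
theorem exists_farFrom_of_linking_eq_zero (J : JordanData X X' n g) (s : ℕ) :
    ∃ r, ∀ c : X.Chains, X.FarFrom (g '' Set.univ) r (X.boundary c) → J.linking c = 0 →
      ∃ c', X.FarFrom (g '' Set.univ) s c' ∧ X.boundary c' = X.boundary c := by
  obtain ⟨r, t, h⟩ := J.exists_farFrom_of_coboundary s
  refine ⟨max r (1 + J.G.L + J.d.D), fun c hc hl => ?_⟩
  have h0 : X'.coboundary (J.pullback (J.d.Pbar c)) = 0 := by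
    rw [J.coboundary_pullback, J.d.coboundary_Pbar]
    exact J.pullback_eq_zero ((hc.mono (le_max_right _ _)).map J.d.displacement_Pbar)
  obtain ⟨e, he⟩ := exists_boundary_eq J.acyclic' (J.d'.P (J.pullback (J.d.Pbar c)))
    (by rw [J.d'.boundary_P, h0, map_zero]) hl
  refine h Set.univ c (J.d'.Pbar e - J.d'.Phibar (J.pullback (J.d.Pbar c)))
    (hc.mono (le_max_left _ _)) ?_
  have h1 := J.d'.cohomotopy (J.pullback (J.d.Pbar c))
  rw [h0, map_zero, add_zero] at h1
  rw [map_sub, J.d'.coboundary_Pbar, he, h1, sub_sub_cancel, sub_self]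
  intro τ hτ
  simp at hτ

/-- In a coarsely proper subset of `X'` there is room to push the linking number away. -/
theorem exists_farFrom_of_unbounded (J : JordanData X X' n g) (s : ℕ) {Z : Set V'}
    (hZ : ∀ t : ℕ, ∃ w, ∀ z ∈ Z, t ≤ X'.dist z w) :
    ∃ r, ∀ c : X.Chains, (∀ τ ∈ c.support, τ.1.card = 2) →
      X.FarFrom (g '' Z) r (X.boundary c) →
      ∃ c', X.FarFrom (g '' Z) s c' ∧ X.boundary c' = X.boundary c := by
  obtain ⟨r, t, h⟩ := J.exists_farFrom_of_coboundary s
  refine ⟨max r (t + J.d'.D + J.G.L + J.d.D), fun c hcard hc => ?_⟩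
  set α := J.pullback (J.d.Pbar c) with hα
  obtain ⟨w, hw⟩ := hZ (t + J.d'.D)
  have hδα : X'.FarFrom Z (t + J.d'.D) (X'.coboundary α) := by
    rw [hα, J.coboundary_pullback, J.d.coboundary_Pbar]
    exact J.farFrom_pullback ((hc.mono (le_max_right _ _)).map J.d.displacement_Pbar)
  -- Since `c` is a 1-chain, `P α` is a 0-chain and hence a cycle although `α` need not be a
  -- cocycle.
  have hPα : ∀ τ ∈ (J.d'.P α).support, τ.1.card = 1 := by
    intro τ hτ
    obtain ⟨σ, hσ, hτσ⟩ := Finsupp.exists_mem_support_of_mem_support_map _ hτ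
    obtain ⟨ρ, hρ, hρσ⟩ := Finsupp.exists_mem_support_of_transpose _ _ hσ
    obtain ⟨κ, hκ, hρκ⟩ := Finsupp.exists_mem_support_of_mem_support_map _ hρ
    have h1 := J.d'.card_P σ τ hτσ
    have h2 := J.G.card_map σ ρ hρσ
    have h3 := J.d.card_Pbar κ ρ hρκ
    have h4 := hcard κ hκ
    omega
  -- The whole augmentation is concentrated at the vertex `w` far from `Z`, where it does no harm;
  -- what is left bounds.
  obtain ⟨e, he⟩ := exists_boundary_eq J.acyclic'
    (J.d'.P α - X'.augmentation (J.d'.P α) • X'.vertexChain w)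
    (by rw [map_sub, map_smul, boundary_vertexChain, X'.boundary_eq_zero_of_card hPα, smul_zero,
      sub_zero])
    (by rw [map_sub, map_smul, augmentation_vertexChain, smul_eq_mul, mul_one, sub_self])
  have hwfar : X'.FarFrom Z (t + J.d'.D) (X'.augmentation (J.d'.P α) • X'.vertexChain w) := by
    intro τ hτ x hx z hz
    have h1 := Finset.mem_singleton.1
      (Finsupp.support_single_subset (Finsupp.support_smul hτ))
    rw [h1, Finset.mem_singleton] at hx
    rw [hx]
    exact hw z hz
  refine h Z c (J.d'.Pbar e - J.d'.Phibar α) (hc.mono (le_max_left _ _)) ?_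
  have h1 := eq_sub_of_add_eq (J.d'.cohomotopy α)
  have h2 : α - X'.coboundary (J.d'.Pbar e - J.d'.Phibar α) =
      J.d'.Pbar (X'.augmentation (J.d'.P α) • X'.vertexChain w) -
        J.d'.Phibar (X'.coboundary α) := by
    rw [map_sub, J.d'.coboundary_Pbar, he, h1, map_sub]
    abel
  rw [← hα, h2]
  exact (hwfar.map J.d'.displacement_Pbar).sub (hδα.map J.d'.displacement_Phibar)

/-- Near each point of `g(X')` there is a chain of linking number one; its boundary is far from
`g(X')` but does not bound far from `g(X')`. -/
theorem exists_linking_eq_one (J : JordanData X X' n g) (r : ℕ) :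
    ∃ S, ∀ v : V', ∃ c : X.Chains, (∀ τ ∈ c.support, τ.1.card = 2) ∧ X.NearTo (g v) S c ∧
      X.FarFrom (g '' Set.univ) r (X.boundary c) ∧ J.linking c = 1 := by
  -- Large enough for `∂(P a)` to be `r`-far, for `Phibar (δa)` to pull back to zero, and for the
  -- image of `G` to lie in the domain of `h`.
  set s := r + J.d.D + (1 + J.G.L) with hs
  obtain ⟨h⟩ := J.exists_retraction s
  obtain ⟨H, hHp, hH⟩ := h.exists_homotopy' (by omega)
  refine ⟨J.d'.D + h.h.L + s + J.d.D, fun v => ?_⟩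
  set α := J.d'.Pbar (X'.vertexChain v) with hα
  have hδα : X'.coboundary α = 0 := by
    rw [hα, J.d'.coboundary_Pbar, boundary_vertexChain, map_zero]
  have hαv : X'.NearTo v (0 + J.d'.D) α := by
    refine NearTo.map J.d'.displacement_Pbar fun τ hτ w hw => ?_
    rw [Finset.mem_singleton.1 (Finsupp.support_single_subset hτ), Finset.mem_singleton] at hw
    rw [hw, dist_self]
  set a := Finsupp.transpose h.h.map h.isProper α with ha
  -- The cochain `α` is a cocycle, and `h` is a chain map on simplices within `s` of `g(X')`; `δa`
  -- lives only where `h` is cut off.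
  have hδa : X.FarFrom (g '' Set.univ) s (X.coboundary a) := by
    rintro σ hσ w hw _ ⟨z, -, rfl⟩
    by_contra hlt
    have hσS : (σ.1 : Set V) ⊆ {u | ∃ v, X.dist (g v) u ≤ s} := by
      intro u hu
      have h1 := X.dist_le_one σ.2 hw hu
      have h2 := X.dist_triangle (g z) w u
      exact ⟨z, by omega⟩
    refine Finsupp.mem_support_iff.1 hσ ?_
    rw [ha, h.h.coboundary_transpose_apply _ _ hσS, hδα]
    exact Finsupp.pairing_eq_zero fun _ _ => rfl
  refine ⟨J.d.P a, ?_, ?_, ?_, ?_⟩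
  · intro τ hτ
    obtain ⟨σ, hσ, hτσ⟩ := Finsupp.exists_mem_support_of_mem_support_map _ hτ
    obtain ⟨ρ, hρ, hρσ⟩ := Finsupp.exists_mem_support_of_transpose _ _ hσ
    obtain ⟨κ, hκ, hρκ⟩ := Finsupp.exists_mem_support_of_mem_support_map _ hρ
    have h1 := J.d.card_P σ τ hτσ
    have h2 := h.h.card_map σ ρ hρσ
    have h3 := J.d'.card_Pbar κ ρ hρκ
    rw [Finset.mem_singleton.1 (Finsupp.support_single_subset hκ), Finset.card_singleton] at h3
    omega
  · refine NearTo.map J.d.displacement_P fun σ hσ u hu => ?_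
    obtain ⟨τ, hτ, hτσ⟩ := Finsupp.exists_mem_support_of_transpose _ _ hσ
    have hσS : (σ.1 : Set V) ⊆ {u | ∃ v, X.dist (g v) u ≤ s} := by
      by_contra hn
      rw [h.h.map_single σ hn] at hτσ
      simp at hτσ
    obtain ⟨x, hx⟩ := nonempty_of_mem τ.2
    obtain ⟨z, hz⟩ := hσS hu
    have h1 := hαv τ hτ x hx
    have h2 := h.h.displacement σ hσS τ hτσ u hu x hx
    have h3 := h.dist_φ u z hz
    have h4 := X'.dist_triangle v x (h.φ u)
    have h5 := X'.dist_comm x (h.φ u)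
    have h6 := J.dist_map v (h.φ u)
    have h7 := X.dist_triangle (g v) (g (h.φ u)) u
    omega
  · rw [J.d.boundary_P]
    exact (hδa.mono (by omega)).map J.d.displacement_P
  -- Up to coboundaries, `g^* Pbar P a` is `g^* a = (h ∘ G)^* α`, which is cohomologous to `α`. So
  -- the linking number is the augmentation of `P Pbar v` in `X'`, which is that of `v`.
  · have h1 := eq_add_of_sub_eq (J.d.cohomotopy a).symm
    have h2 : J.pullback (J.d.Phibar (X.coboundary a)) = 0 :=
      J.pullback_eq_zero ((hδa.mono (by omega)).map J.d.displacement_Phibar)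
    have h3 : J.pullback a = α + X'.coboundary (Finsupp.transpose H hHp α) := by
      ext σ
      rw [← Finsupp.pairing_single, J.pairing_pullback, ha, Finsupp.pairing_transpose,
        eq_add_of_sub_eq (hH σ).symm, map_add, map_add, ← pairing_coboundary, hδα,
        Finsupp.add_apply, coboundary_apply, Finsupp.pairing_transpose, Finsupp.pairing_single,
        Finsupp.pairing_eq_zero (α := (0 : X'.Cochains)) fun _ _ => rfl]
      ring
    have h4 := eq_add_of_sub_eq (J.d'.homotopy (X'.vertexChain v)).symm
    rw [linking_apply, h1]
    simp only [map_add]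
    rw [h2, ← J.coboundary_pullback, ← J.d'.boundary_P, augmentation_boundary, h3]
    simp only [map_add, map_zero]
    rw [← J.d'.boundary_P, augmentation_boundary, hα, h4]
    simp only [map_add, boundary_vertexChain, map_zero, augmentation_boundary,
      augmentation_vertexChain]
    norm_num

/-- Otherwise `c - c'` is a cycle of augmentation zero, hence a boundary, and has linking number
zero; but `c'` is too far away to contribute. -/
theorem boundary_ne_of_linking_eq_one (J : JordanData X X' n g) {c c' : X.Chains}
    (hc : J.linking c = 1) (haug : X.augmentation c = 0) (haug' : X.augmentation c' = 0)
    (hc' : X.FarFrom (g '' Set.univ) (1 + J.G.L + J.d.D) c') : X.boundary c' ≠ X.boundary c := by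
  intro h
  obtain ⟨e, he⟩ := exists_boundary_eq J.acyclic (c - c') (by rw [map_sub, h, sub_self])
    (by rw [map_sub, haug, haug', sub_self])
  have h1 := J.linking_boundary e
  rw [he, map_sub, J.linking_eq_zero hc', hc] at h1
  norm_num at h1

end JordanData

end MetricSimplicialComplex

namespace MetricSimplicialComplex

variable {V V' : Type*}

/-! ### Edge paths far from a set of vertices -/

/-- The vertices at distance at least `r` from `K`. -/
def farSet (X : MetricSimplicialComplex V) (K : Set V) (r : ℕ) : Set V :=
  {v | ∀ k ∈ K, r ≤ X.dist k v}

/-- Two vertices are joined by an edge path in `S`. -/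
def JoinedWithin (X : MetricSimplicialComplex V) (S : Set V) : V → V → Prop :=
  Relation.ReflTransGen fun a b => X.oneSkeleton.Adj a b ∧ a ∈ S ∧ b ∈ S

theorem JoinedWithin.symm {X : MetricSimplicialComplex V} {S : Set V} {x y : V}
    (h : X.JoinedWithin S x y) : X.JoinedWithin S y x :=
  letI : Std.Symm fun a b => X.oneSkeleton.Adj a b ∧ a ∈ S ∧ b ∈ S :=
    ⟨fun _ _ h => ⟨h.1.symm, h.2.2, h.2.1⟩⟩
  Relation.ReflTransGen.stdSymm.symm _ _ h

theorem joinedWithin_iff_of_mem {X : MetricSimplicialComplex V} {S : Set V} {σ : Finset V}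
    (hσ : σ ∈ X.faces) (hS : (σ : Set V) ⊆ S) (x : V) {v w : V} (hv : v ∈ σ) (hw : w ∈ σ) :
    X.JoinedWithin S x v ↔ X.JoinedWithin S x w := by
  by_cases h : v = w
  · rw [h]
  · exact ⟨fun hx => hx.tail ⟨⟨h, σ, hσ, hv, hw⟩, hS hv, hS hw⟩,
      fun hx => hx.tail ⟨⟨Ne.symm h, σ, hσ, hw, hv⟩, hS hw, hS hv⟩⟩

theorem joinedWithin_univ (X : MetricSimplicialComplex V) (x y : V) :
    X.JoinedWithin Set.univ x y := by
  have h : Relation.ReflTransGen X.oneSkeleton.Adj x y :=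
    (SimpleGraph.reachable_iff_reflTransGen x y).1 (X.connected.preconnected x y)
  exact Relation.ReflTransGen.mono (fun a b hab => ⟨hab, Set.mem_univ a, Set.mem_univ b⟩) x y h

theorem FarFrom.smul {X : MetricSimplicialComplex V} {K : Set V} {r : ℕ} {c : X.Chains}
    (h : X.FarFrom K r c) (m : ℤ) : X.FarFrom K r (m • c) :=
  fun τ hτ => h τ (Finsupp.support_smul hτ)

theorem farFrom_vertexChain {X : MetricSimplicialComplex V} {K : Set V} {r : ℕ} {v : V}
    (h : v ∈ X.farSet K r) : X.FarFrom K r (X.vertexChain v) := by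
  intro τ hτ w hw
  rw [Finset.mem_singleton.1 (Finsupp.support_single_subset hτ), Finset.mem_singleton] at hw
  rw [hw]
  exact h

section Chains

variable [LinearOrder V] [LinearOrder V']

theorem exists_chain_of_adj (X : MetricSimplicialComplex V) {a b : V}
    (h : X.oneSkeleton.Adj a b) : ∃ c : X.Chains,
      (∀ τ ∈ c.support, τ.1 = {a, b}) ∧ X.boundary c = X.vertexChain b - X.vertexChain a := by
  obtain ⟨hne, σ, hσ, ha, hb⟩ := h
  have hab : {a, b} ∈ X.faces := mem_faces_of_subset hσ
    (Finset.insert_subset ha (Finset.singleton_subset_iff.2 hb)) ⟨a, by simp⟩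
  rcases lt_or_gt_of_ne hne with h | h
  · refine ⟨Finsupp.single ⟨{a, b}, hab⟩ 1, fun τ hτ => ?_, X.boundary_edge h hab⟩
    rw [Finset.mem_singleton.1 (Finsupp.support_single_subset hτ)]
  · have hba : {b, a} ∈ X.faces := Finset.pair_comm a b ▸ hab
    refine ⟨-Finsupp.single ⟨{b, a}, hba⟩ 1, fun τ hτ => ?_, ?_⟩
    · rw [Finsupp.support_neg] at hτ
      rw [Finset.mem_singleton.1 (Finsupp.support_single_subset hτ)]
      exact Finset.pair_comm b a
    · rw [map_neg, X.boundary_edge h hba, neg_sub]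

theorem JoinedWithin.exists_chain {X : MetricSimplicialComplex V} {S : Set V} {x y : V}
    (h : X.JoinedWithin S x y) : ∃ c : X.Chains,
      (∀ τ ∈ c.support, τ.1.card = 2 ∧ (τ.1 : Set V) ⊆ S) ∧
      X.boundary c = X.vertexChain y - X.vertexChain x := by
  induction h with
  | refl => exact ⟨0, fun τ hτ => by simp at hτ, by simp⟩
  | tail _ hab ih =>
    obtain ⟨c, hc, hcb⟩ := ih
    obtain ⟨c', hc', hcb'⟩ := X.exists_chain_of_adj hab.1
    refine ⟨c + c', fun τ hτ => ?_, by rw [map_add, hcb, hcb']; abel⟩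
    rcases Finset.mem_union.1 (Finsupp.support_add hτ) with hτ | hτ
    · exact hc τ hτ
    · rw [hc' τ hτ]
      refine ⟨Finset.card_pair hab.1.1, ?_⟩
      rw [Finset.coe_pair]
      exact Set.insert_subset hab.2.1 (Set.singleton_subset_iff.2 hab.2.2)

-- Each simplex of `c` lies in the far set, so the indicator of the path component of `x` is
-- constant on it.
open Classical in
theorem FarFrom.weightedAugmentation_boundary {X : MetricSimplicialComplex V} {K : Set V} {r : ℕ}
    {c : X.Chains} (h : X.FarFrom K r c) (x : V) : X.weightedAugmentation
      (fun v => if X.JoinedWithin (X.farSet K r) x v then 1 else 0) (X.boundary c) = 0 := by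
  refine X.weightedAugmentation_boundary _ c fun τ hτ v hv w hw => ?_
  have h1 := joinedWithin_iff_of_mem τ.2 (fun u hu => h τ hτ u hu) x hv hw
  exact if_congr h1 rfl rfl

/-- A zero-chain of augmentation zero on vertices that are mutually joined within `S` bounds
within `S`. -/
theorem exists_boundary_eq_of_joinedWithin {X : MetricSimplicialComplex V} {S : Set V}
    {z : X.Chains} (hz : ∀ σ ∈ z.support, σ.1.card = 1) (haug : X.augmentation z = 0)
    (hS : ∀ x y, (∃ σ ∈ z.support, x ∈ σ.1) → (∃ σ ∈ z.support, y ∈ σ.1) →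
      X.JoinedWithin S x y) :
    ∃ c : X.Chains, (∀ τ ∈ c.support, τ.1.card = 2 ∧ (τ.1 : Set V) ⊆ S) ∧
      X.boundary c = z := by
  rcases eq_or_ne z 0 with rfl | hne
  · exact ⟨0, fun τ hτ => by simp at hτ, map_zero _⟩
  obtain ⟨σ₀, hσ₀⟩ := Finsupp.support_nonempty_iff.2 hne
  obtain ⟨x₀, hx₀⟩ := nonempty_of_mem σ₀.2
  have key : ∀ σ : X.faces, ∃ p : X.Chains,
      (∀ τ ∈ p.support, τ.1.card = 2 ∧ (τ.1 : Set V) ⊆ S) ∧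
      (σ ∈ z.support → X.boundary p = Finsupp.single σ 1 - X.vertexChain x₀) := by
    intro σ
    by_cases hσ : σ ∈ z.support
    · obtain ⟨y, hy⟩ := Finset.card_eq_one.1 (hz σ hσ)
      obtain ⟨p, hp, hpb⟩ :=
        (hS x₀ y ⟨σ₀, hσ₀, hx₀⟩ ⟨σ, hσ, by simp [hy]⟩).exists_chain
      have h1 : σ = ⟨{y}, X.singleton_mem y⟩ := Subtype.ext hy
      exact ⟨p, hp, fun _ => by rw [hpb, h1, vertexChain]⟩
    · exact ⟨0, fun τ hτ => by simp at hτ, fun h => (hσ h).elim⟩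
  choose p hp hpb using key
  refine ⟨Finsupp.linearCombination ℤ p z, fun τ hτ => ?_, ?_⟩
  · obtain ⟨σ, -, hτσ⟩ := Finsupp.exists_mem_support_of_mem_support_map _ hτ
    rw [Finsupp.linearCombination_single, one_smul] at hτσ
    exact hp σ τ hτσ
  -- Joining every vertex of `z` to `x₀` gives a chain with boundary `z - ε(z) x₀`, and `ε(z) = 0`.
  · have h1 := Finsupp.map_eq_of_forall_single (X.boundary ∘ₗ Finsupp.linearCombination ℤ p)
      (LinearMap.id - X.augmentation.smulRight (X.vertexChain x₀)) (c := z) fun σ hσ => by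
        simp [hpb σ hσ, augmentation, hz σ hσ]
    simpa [haug] using h1

/-! ### Edge paths avoiding the image of `g` -/

namespace JordanData

variable {X : MetricSimplicialComplex V} {X' : MetricSimplicialComplex V'} {n : ℤ} {g : V' → V}

/-- Two paths from `x`, to `y` and to `z`, have an integer combination of linking number zero, whose
boundary bounds far away. Counting it on separate components leaves no room for three classes. -/
theorem exists_joinedWithin_of_three (J : JordanData X X' n g) (s : ℕ) :
    ∃ r, ∀ x ∈ X.farSet (g '' Set.univ) r, ∀ y ∈ X.farSet (g '' Set.univ) r,
      ∀ z ∈ X.farSet (g '' Set.univ) r, X.JoinedWithin (X.farSet (g '' Set.univ) s) x y ∨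
        X.JoinedWithin (X.farSet (g '' Set.univ) s) x z ∨
        X.JoinedWithin (X.farSet (g '' Set.univ) s) y z := by
  classical
  obtain ⟨r, hr⟩ := J.exists_farFrom_of_linking_eq_zero s
  refine ⟨r, fun x hx y hy z hz => ?_⟩
  by_contra! hn
  obtain ⟨hxy, hxz, hyz⟩ := hn
  obtain ⟨p, -, hp⟩ := (X.joinedWithin_univ x y).exists_chain
  obtain ⟨q, -, hq⟩ := (X.joinedWithin_univ x z).exists_chain
  have hpf : X.FarFrom (g '' Set.univ) r (X.boundary p) := by
    rw [hp]
    exact (farFrom_vertexChain hy).sub (farFrom_vertexChain hx)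
  have hqf : X.FarFrom (g '' Set.univ) r (X.boundary q) := by
    rw [hq]
    exact (farFrom_vertexChain hz).sub (farFrom_vertexChain hx)
  obtain ⟨c, hc, hcb⟩ := hr (J.linking q • p - J.linking p • q)
    (by rw [map_sub, map_smul, map_smul]; exact (hpf.smul _).sub (hqf.smul _))
    (by rw [map_sub, map_smul, map_smul, smul_eq_mul, smul_eq_mul, mul_comm, sub_self])
  -- Only `q` ends in the component of `z`, and its coefficient in the combination is `-linking p`.
  have hpl : J.linking p = 0 := by
    have h1 := hc.weightedAugmentation_boundary z
    rw [hcb] at h1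
    simpa [-Set.image_univ, hp, hq, weightedAugmentation_vertexChain, show ¬ X.JoinedWithin
      (X.farSet (g '' Set.univ) s) z x from fun h => hxz h.symm, show ¬ X.JoinedWithin
      (X.farSet (g '' Set.univ) s) z y from fun h => hyz h.symm, show X.JoinedWithin
      (X.farSet (g '' Set.univ) s) z z from Relation.ReflTransGen.refl] using h1
  obtain ⟨c', hc', hcb'⟩ := hr p hpf hpl
  have h1 := hc'.weightedAugmentation_boundary x
  rw [hcb', hp] at h1
  simp [-Set.image_univ, weightedAugmentation_vertexChain, hxy, show X.JoinedWithin
      (X.farSet (g '' Set.univ) s) x x from Relation.ReflTransGen.refl] at h1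

theorem exists_joinedWithin_of_unbounded (J : JordanData X X' n g) (s : ℕ) {Z : Set V'}
    (hZ : ∀ t : ℕ, ∃ w, ∀ z ∈ Z, t ≤ X'.dist z w) :
    ∃ r, ∀ x ∈ X.farSet (g '' Z) r, ∀ y ∈ X.farSet (g '' Z) r,
      X.JoinedWithin (X.farSet (g '' Z) s) x y := by
  classical
  obtain ⟨r, hr⟩ := J.exists_farFrom_of_unbounded s hZ
  refine ⟨r, fun x hx y hy => ?_⟩
  by_contra hxy
  obtain ⟨p, hp2, hp⟩ := (X.joinedWithin_univ x y).exists_chain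
  obtain ⟨c, hc, hcb⟩ := hr p (fun τ hτ => (hp2 τ hτ).1) (by
    rw [hp]
    exact (farFrom_vertexChain hy).sub (farFrom_vertexChain hx))
  have h1 := hc.weightedAugmentation_boundary x
  rw [hcb, hp] at h1
  simp [weightedAugmentation_vertexChain, hxy, show X.JoinedWithin
      (X.farSet (g '' Z) s) x x from Relation.ReflTransGen.refl] at h1

/-- If all far vertices near `g v` were joined in the far set, the boundary of the linking-one chain
near `g v` would bound there. The separating radius `s` does not depend on `r`. -/
theorem exists_not_joinedWithin (J : JordanData X X' n g) :
    ∃ s, ∀ r, ∃ S, ∀ v, ∃ x ∈ X.farSet (g '' Set.univ) r, ∃ y ∈ X.farSet (g '' Set.univ) r,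
      X.dist (g v) x ≤ S ∧ X.dist (g v) y ≤ S ∧
      ¬ X.JoinedWithin (X.farSet (g '' Set.univ) s) x y := by
  refine ⟨1 + J.G.L + J.d.D, fun r => ?_⟩
  obtain ⟨S, hS⟩ := J.exists_linking_eq_one r
  refine ⟨S, fun v => ?_⟩
  obtain ⟨c, hc2, hcS, hcr, hc⟩ := hS v
  by_contra! hn
  have hmem : ∀ x, (∃ σ ∈ (X.boundary c).support, x ∈ σ.1) →
      x ∈ X.farSet (g '' Set.univ) r ∧ X.dist (g v) x ≤ S := by
    rintro x ⟨σ, hσ, hx⟩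
    obtain ⟨τ, hτ, hστ⟩ := Finsupp.exists_mem_support_of_mem_support_map _ hσ
    exact ⟨hcr σ hσ x hx, hcS τ hτ x (X.subset_of_mem_support_boundary hστ hx)⟩
  obtain ⟨c', hc', hcb⟩ := exists_boundary_eq_of_joinedWithin (z := X.boundary c)
    (S := X.farSet (g '' Set.univ) (1 + J.G.L + J.d.D)) (fun σ hσ => by
      obtain ⟨τ, hτ, hστ⟩ := Finsupp.exists_mem_support_of_mem_support_map _ hσ
      have h1 := X.card_of_mem_support_boundary hστ
      have h2 := hc2 τ hτ
      omega) (X.augmentation_boundary c)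
    fun x y hx hy => hn x (hmem x hx).1 y (hmem y hy).1 (hmem x hx).2 (hmem y hy).2
  refine J.boundary_ne_of_linking_eq_one hc (X.augmentation_eq_zero fun τ hτ => ?_)
    (X.augmentation_eq_zero fun τ hτ => ?_) (fun τ hτ w hw => (hc' τ hτ).2 hw) hcb
  · rw [hc2 τ hτ]
    norm_num
  · rw [(hc' τ hτ).1]
    norm_num

end JordanData

end Chains

/-! ### Components of complements -/

/-- The closed cell of the realization spanned by `σ`. -/
def cell (σ : Finset V) : Set (V → ℝ) :=
  {x | (∀ v, 0 ≤ x v) ∧ (∀ v, v ∉ σ → x v = 0) ∧ ∑ v ∈ σ, x v = 1}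

theorem convex_cell (σ : Finset V) : Convex ℝ (cell σ) := by
  rintro x ⟨hx1, hx2, hx3⟩ y ⟨hy1, hy2, hy3⟩ a b ha hb hab
  refine ⟨fun v => ?_, fun v hv => ?_, ?_⟩
  · have h1 := hx1 v
    have h2 := hy1 v
    simp only [Pi.add_apply, Pi.smul_apply, smul_eq_mul]
    positivity
  · simp [hx2 v hv, hy2 v hv]
  · simp only [Pi.add_apply, Pi.smul_apply, smul_eq_mul, Finset.sum_add_distrib,
      ← Finset.mul_sum, hx3, hy3, mul_one, hab]

theorem exists_ne_zero_of_mem_cell {σ : Finset V} {x : V → ℝ} (hx : x ∈ cell σ) :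
    ∃ v ∈ σ, x v ≠ 0 :=
  Finset.exists_ne_zero_of_sum_ne_zero (by rw [hx.2.2]; exact one_ne_zero)

theorem cell_subset_realization (X : MetricSimplicialComplex V) {σ : Finset V}
    (hσ : σ ∈ X.faces) : cell σ ⊆ X.toPreAbstractSimplicialComplex.realization := by
  classical
  intro x hx
  refine ⟨hx.1, σ.filter (x · ≠ 0), mem_faces_of_subset hσ (Finset.filter_subset _ _) ?_, ?_, ?_⟩
  · obtain ⟨v, hv, hxv⟩ := exists_ne_zero_of_mem_cell hx
    exact ⟨v, Finset.mem_filter.2 ⟨hv, hxv⟩⟩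
  · intro v
    rw [Finset.mem_filter]
    refine ⟨fun h => h.2, fun h => ⟨?_, h⟩⟩
    by_contra hv
    exact h (hx.2.1 v hv)
  · rw [Finset.sum_filter_ne_zero]
    exact hx.2.2

theorem mem_cell_of_mem_realization {K : PreAbstractSimplicialComplex V} {x : V → ℝ}
    (hx : x ∈ K.realization) : ∃ σ ∈ K.faces, (∀ v, v ∈ σ ↔ x v ≠ 0) ∧ x ∈ cell σ := by
  obtain ⟨h0, σ, hσ, hσx, hsum⟩ := hx
  refine ⟨σ, hσ, hσx, h0, fun v hv => ?_, hsum⟩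
  by_contra h
  exact hv ((hσx v).2 h)

/-- The vertices of a subcomplex. -/
def vertexSet (K : PreAbstractSimplicialComplex V) : Set V := {k | {k} ∈ K.faces}

/-- All vertices of `N_R(K)` are within `R` of `K`, while a simplex is certain to lie in `N_R(K)`
only if it has a vertex at distance less than `R`. Hence the loss of one unit between this and
`mem_farSet_of_mem_complement`. -/
theorem mem_complement_of_mem_farSet {X : MetricSimplicialComplex V}
    {K : PreAbstractSimplicialComplex V} {R : ℕ} {x : V → ℝ}
    (hx : x ∈ X.toPreAbstractSimplicialComplex.realization) {v : V} (hv : x v ≠ 0)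
    (hvR : v ∈ X.farSet (vertexSet K) (R + 1)) : x ∈ X.complement R K := by
  refine ⟨hx, fun hx' => ?_⟩
  obtain ⟨σ, hσ, hσx, -⟩ := mem_cell_of_mem_realization hx'
  obtain ⟨k, hk, hkv⟩ := X.exists_dist_le_of_mem_nbhd hσ ((hσx v).2 hv)
  have := hvR k hk
  omega

theorem mem_farSet_of_mem_complement {X : MetricSimplicialComplex V}
    {K : PreAbstractSimplicialComplex V} {R : ℕ} {x : V → ℝ} (hx : x ∈ X.complement R K) {v : V}
    (hv : x v ≠ 0) : v ∈ X.farSet (vertexSet K) R := by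
  intro k hk
  by_contra hlt
  obtain ⟨σ, hσ, hσx, hcell⟩ := mem_cell_of_mem_realization hx.1
  exact hx.2 ⟨hcell.1, σ, X.mem_nbhd_of_dist_lt hσ ((hσx v).2 hv) hk (not_le.1 hlt), hσx,
    hcell.2.2⟩

theorem exists_ne_zero_of_mem_complement {X : MetricSimplicialComplex V}
    {K : PreAbstractSimplicialComplex V} {R : ℕ} {x : V → ℝ} (hx : x ∈ X.complement R K) :
    ∃ v, x v ≠ 0 := by
  obtain ⟨σ, -, -, hcell⟩ := mem_cell_of_mem_realization hx.1
  exact (exists_ne_zero_of_mem_cell hcell).imp fun v hv => hv.2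

theorem cell_subset_complement {X : MetricSimplicialComplex V}
    {K : PreAbstractSimplicialComplex V} {R : ℕ} {σ : Finset V} (hσ : σ ∈ X.faces)
    (h : (σ : Set V) ⊆ X.farSet (vertexSet K) (R + 1)) : cell σ ⊆ X.complement R K := by
  intro x hx
  obtain ⟨v, hv, hxv⟩ := exists_ne_zero_of_mem_cell hx
  exact mem_complement_of_mem_farSet (X.cell_subset_realization hσ hx) hxv (h hv)

theorem single_mem_cell [DecidableEq V] {σ : Finset V} {v : V} (hv : v ∈ σ) :
    (Pi.single v 1 : V → ℝ) ∈ cell σ := by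
  refine ⟨fun w => ?_, fun w hw => ?_, ?_⟩
  · rw [Pi.single_apply]
    split_ifs <;> norm_num
  · rw [Pi.single_apply, if_neg]
    rintro rfl
    exact hw hv
  · simp [Pi.single_apply, hv]

theorem single_mem_complement [DecidableEq V] {X : MetricSimplicialComplex V}
    {K : PreAbstractSimplicialComplex V} {R : ℕ} {v : V}
    (hv : v ∈ X.farSet (vertexSet K) (R + 1)) : (Pi.single v 1 : V → ℝ) ∈ X.complement R K :=
  cell_subset_complement (X.singleton_mem v) (by simpa using hv)
    (single_mem_cell (Finset.mem_singleton_self v))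

theorem mem_connectedComponentIn_of_cell {X : MetricSimplicialComplex V}
    {K : PreAbstractSimplicialComplex V} {R : ℕ} {σ : Finset V} (hσ : σ ∈ X.faces)
    (h : (σ : Set V) ⊆ X.farSet (vertexSet K) (R + 1)) {x y : V → ℝ} (hx : x ∈ cell σ)
    (hy : y ∈ cell σ) : y ∈ connectedComponentIn (X.complement R K) x :=
  (convex_cell σ).isPreconnected.subset_connectedComponentIn hx (cell_subset_complement hσ h) hy

theorem JoinedWithin.single_mem_connectedComponentIn [DecidableEq V] {X : MetricSimplicialComplex V}
    {K : PreAbstractSimplicialComplex V} {R : ℕ} {v w : V}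
    (hv : v ∈ X.farSet (vertexSet K) (R + 1))
    (h : X.JoinedWithin (X.farSet (vertexSet K) (R + 1)) v w) :
    (Pi.single w 1 : V → ℝ) ∈ connectedComponentIn (X.complement R K) (Pi.single v 1) := by
  induction h with
  | refl => exact mem_connectedComponentIn (single_mem_complement hv)
  | @tail a b _ hab ih =>
    obtain ⟨⟨-, σ, hσ, ha, hb⟩, haS, hbS⟩ := hab
    rw [connectedComponentIn_eq ih]
    refine mem_connectedComponentIn_of_cell (σ := {a, b}) (mem_faces_of_subset hσ
      (Finset.insert_subset ha (Finset.singleton_subset_iff.2 hb)) ⟨a, by simp⟩) ?_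
      (single_mem_cell (by simp)) (single_mem_cell (by simp))
    rw [Finset.coe_pair]
    exact Set.insert_subset haS (Set.singleton_subset_iff.2 hbS)

theorem JoinedWithin.mem_connectedComponentIn {X : MetricSimplicialComplex V}
    {K : PreAbstractSimplicialComplex V} {R : ℕ} {x y : V → ℝ} (hx : x ∈ X.complement (R + 1) K)
    (hy : y ∈ X.complement (R + 1) K) {v w : V} (hv : x v ≠ 0) (hw : y w ≠ 0)
    (h : X.JoinedWithin (X.farSet (vertexSet K) (R + 1)) v w) :
    y ∈ connectedComponentIn (X.complement R K) x := by
  classical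
  obtain ⟨σ, hσ, hσx, hxσ⟩ := mem_cell_of_mem_realization hx.1
  obtain ⟨τ, hτ, hτy, hyτ⟩ := mem_cell_of_mem_realization hy.1
  have h1 := mem_connectedComponentIn_of_cell hσ
    (fun u hu => mem_farSet_of_mem_complement hx ((hσx u).1 hu)) hxσ
    (single_mem_cell ((hσx v).2 hv))
  have h2 := h.single_mem_connectedComponentIn (mem_farSet_of_mem_complement hx hv)
  have h3 := mem_connectedComponentIn_of_cell hτ
    (fun u hu => mem_farSet_of_mem_complement hy ((hτy u).1 hu))
    (single_mem_cell ((hτy w).2 hw)) hyτ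
  rwa [connectedComponentIn_eq h1, connectedComponentIn_eq h2]

theorem joinedWithin_of_mem_connectedComponentIn {X : MetricSimplicialComplex V}
    {K : PreAbstractSimplicialComplex V} {R : ℕ} {x y : V → ℝ}
    (h : y ∈ connectedComponentIn (X.complement R K) x) {v w : V} (hv : x v ≠ 0) (hw : y w ≠ 0) :
    X.JoinedWithin (X.farSet (vertexSet K) R) v w := by
  by_contra hn
  -- The unions of open stars of the vertices joined to `v`, and of those not joined to `v`, are
  -- open and cover the component. By connectedness they share a point, whose carrier simplex would
  -- then have vertices of both kinds.
  have hopen : ∀ Q : Set V, IsOpen {p : V → ℝ | ∃ u ∈ Q, p u ≠ 0} := by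
    intro Q
    have : {p : V → ℝ | ∃ u ∈ Q, p u ≠ 0} = ⋃ u ∈ Q, {p : V → ℝ | p u ≠ 0} := by
      ext p
      simp
    rw [this]
    exact isOpen_biUnion fun u _ => isOpen_ne_fun (continuous_apply u) continuous_const
  have hx : x ∈ connectedComponentIn (X.complement R K) x :=
    _root_.mem_connectedComponentIn (connectedComponentIn_nonempty_iff.1 ⟨y, h⟩)
  obtain ⟨p, hp, ⟨a, ha, hpa⟩, b, hb, hpb⟩ := isPreconnected_connectedComponentIn
    (x := x) (F := X.complement R K) _ _
    (hopen {u | X.JoinedWithin (X.farSet (vertexSet K) R) v u})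
    (hopen {u | ¬ X.JoinedWithin (X.farSet (vertexSet K) R) v u})
    (by
      intro p hp
      obtain ⟨σ, hσ, hσp, hcell⟩ :=
        mem_cell_of_mem_realization (connectedComponentIn_subset _ _ hp).1
      obtain ⟨u, hu, hpu⟩ := exists_ne_zero_of_mem_cell hcell
      by_cases hvu : X.JoinedWithin (X.farSet (vertexSet K) R) v u
      · exact Or.inl ⟨u, hvu, hpu⟩
      · exact Or.inr ⟨u, hvu, hpu⟩)
    ⟨x, hx, v, Relation.ReflTransGen.refl, hv⟩ ⟨y, h, w, hn, hw⟩
  have hpc := connectedComponentIn_subset _ _ hp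
  obtain ⟨σ, hσ, hσp, -⟩ := mem_cell_of_mem_realization hpc.1
  exact hb ((joinedWithin_iff_of_mem hσ
    (fun u hu => mem_farSet_of_mem_complement hpc ((hσp u).1 hu)) v ((hσp a).2 hpa)
    ((hσp b).2 hpb)).1 ha)

theorem nbhd_mono {X : MetricSimplicialComplex V} {K : PreAbstractSimplicialComplex V}
    (hK : K ≤ X.toPreAbstractSimplicialComplex) {r r' : ℕ} (h : r ≤ r') :
    X.nbhd r K ≤ X.nbhd r' K := by
  have hle : ∀ r, X.nbhd r K ≤ X.toPreAbstractSimplicialComplex := by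
    intro r
    cases r with
    | zero => exact hK
    | succ r =>
      rw [nbhd_succ]
      rintro σ ⟨hne, τ, hτ, hστ, -⟩
      exact mem_faces_of_subset hτ hστ hne
  refine monotone_nat_of_le_succ (f := fun r => X.nbhd r K) (fun r => ?_) h
  rw [nbhd_succ]
  intro σ hσ
  have hne := ((X.nbhd r K).isRelLowerSet_faces hσ).1
  obtain ⟨v, hv⟩ := hne
  exact ⟨⟨v, hv⟩, σ, hle r hσ, subset_rfl, v, hv, ((X.nbhd r K).isRelLowerSet_faces hσ).2
    (Finset.singleton_subset_iff.2 hv) (Finset.singleton_nonempty v)⟩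

theorem complement_anti {X : MetricSimplicialComplex V} {K : PreAbstractSimplicialComplex V}
    (hK : K ≤ X.toPreAbstractSimplicialComplex) {r r' : ℕ} (h : r ≤ r') :
    X.complement r' K ⊆ X.complement r K := fun _ hx =>
  ⟨hx.1, fun ⟨h0, σ, hσ, h1⟩ => hx.2 ⟨h0, σ, nbhd_mono hK h hσ, h1⟩⟩

theorem IsDeepComponent.exists_mem_complement {X : MetricSimplicialComplex V}
    {K : PreAbstractSimplicialComplex V} {U C : Set (V → ℝ)} (hC : X.IsDeepComponent K U C)
    (hU : U ⊆ X.toPreAbstractSimplicialComplex.realization) (r : ℕ) :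
    ∃ p ∈ U, C = connectedComponentIn U p ∧ p ∈ X.complement r K := by
  obtain ⟨⟨x, hx, rfl⟩, hdeep⟩ := hC
  obtain ⟨p, hp, hpr⟩ := Set.not_subset.1 (hdeep r)
  have hpU := connectedComponentIn_subset _ _ hp
  exact ⟨p, hpU, connectedComponentIn_eq hp, hU hpU, hpr⟩

end MetricSimplicialComplex

/-! ### Deep components and their stability -/

namespace MetricSimplicialComplex

variable {V V' : Type*}

theorem vertexSet_map [DecidableEq V] (Z : PreAbstractSimplicialComplex V') (g : V' → V) :
    vertexSet (Z.map g) = g '' vertexSet Z := by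
  ext k
  constructor
  · rintro ⟨σ, hσ, hk⟩
    obtain ⟨v, hv⟩ := (Z.isRelLowerSet_faces hσ).1
    refine ⟨v, (Z.isRelLowerSet_faces hσ).2 (Finset.singleton_subset_iff.2 hv)
      (Finset.singleton_nonempty v), ?_⟩
    have h1 : g v ∈ ({k} : Finset V) := hk ▸ Finset.mem_image_of_mem g hv
    exact Finset.mem_singleton.1 h1
  · rintro ⟨v, hv, rfl⟩
    exact ⟨{v}, hv, Finset.image_singleton g v⟩

theorem vertexSet_toPreAbstractSimplicialComplex (X : MetricSimplicialComplex V) :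
    vertexSet X.toPreAbstractSimplicialComplex = Set.univ :=
  Set.eq_univ_of_forall X.singleton_mem

theorem not_mem_connectedComponentIn_symm {α : Type*} [TopologicalSpace α] {F : Set α} {x y : α}
    (hy : y ∈ F) (h : y ∉ connectedComponentIn F x) : x ∉ connectedComponentIn F y := fun hx =>
  h (connectedComponentIn_eq hx ▸ mem_connectedComponentIn hy)

/-- If, at each scale, at most two components reach far and, from scale `R₀` on, there are always
two that do, then these two are the deep components. -/
theorem exists_forall_isDeepComponent_iff {X : MetricSimplicialComplex V}
    {K : PreAbstractSimplicialComplex V} (hK : K ≤ X.toPreAbstractSimplicialComplex) {R₀ : ℕ}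
    (hA : ∀ R, ∃ R', ∀ x ∈ X.complement R' K, ∀ y ∈ X.complement R' K, ∀ z ∈ X.complement R' K,
      y ∈ connectedComponentIn (X.complement R K) x ∨
      z ∈ connectedComponentIn (X.complement R K) x ∨
      z ∈ connectedComponentIn (X.complement R K) y)
    (hB : ∀ R', ∃ x ∈ X.complement R' K, ∃ y ∈ X.complement R' K,
      y ∉ connectedComponentIn (X.complement R₀ K) x) {R : ℕ} (hR : R₀ ≤ R) :
    ∃ R', R ≤ R' ∧ ∀ x ∈ X.complement R' K, ∀ y ∈ X.complement R' K,
      y ∉ connectedComponentIn (X.complement R₀ K) x →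
      (∀ z ∈ X.complement R' K, z ∈ connectedComponentIn (X.complement R K) x ∨
        z ∈ connectedComponentIn (X.complement R K) y) ∧
      ∀ C, X.IsDeepComponent K (X.complement R K) C ↔
        C = connectedComponentIn (X.complement R K) x ∨
        C = connectedComponentIn (X.complement R K) y := by
  obtain ⟨R', hR'⟩ := hA R
  refine ⟨max R R', le_max_left _ _, fun x hx y hy hxy => ?_⟩
  have hmono : ∀ p, connectedComponentIn (X.complement R K) p ⊆
      connectedComponentIn (X.complement R₀ K) p :=
    fun p => connectedComponentIn_mono p (complement_anti hK hR)
  have hc := complement_anti hK (le_max_right R R')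
  have hcR := complement_anti hK (le_max_left R R')
  have hcover : ∀ z ∈ X.complement (max R R') K,
      z ∈ connectedComponentIn (X.complement R K) x ∨
      z ∈ connectedComponentIn (X.complement R K) y := fun z hz =>
    (hR' x (hc hx) y (hc hy) z (hc hz)).resolve_left fun h => hxy (hmono x h)
  -- Separated points `p`, `q` exist arbitrarily far out; they must lie one in each of the two
  -- components, so both are deep.
  have hdeep : ∀ r, ¬ connectedComponentIn (X.complement R K) x ⊆ (X.nbhd r K).realization ∧
      ¬ connectedComponentIn (X.complement R K) y ⊆ (X.nbhd r K).realization := by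
    intro r
    obtain ⟨p, hp, q, hq, hpq⟩ := hB (max r (max R R'))
    have hpr := complement_anti hK (le_max_left r _) hp
    have hqr := complement_anti hK (le_max_left r _) hq
    have hsep : ∀ z, ¬ (p ∈ connectedComponentIn (X.complement R K) z ∧
        q ∈ connectedComponentIn (X.complement R K) z) := by
      rintro z ⟨h1, h2⟩
      rw [connectedComponentIn_eq h1] at h2
      exact hpq (hmono p h2)
    rcases hcover p (complement_anti hK (le_max_right r _) hp) with h1 | h1 <;>
      rcases hcover q (complement_anti hK (le_max_right r _) hq) with h2 | h2
    · exact (hsep x ⟨h1, h2⟩).elim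
    · exact ⟨fun h => hpr.2 (h h1), fun h => hqr.2 (h h2)⟩
    · exact ⟨fun h => hqr.2 (h h2), fun h => hpr.2 (h h1)⟩
    · exact (hsep y ⟨h1, h2⟩).elim
  refine ⟨hcover, fun C => ⟨fun hC => ?_, ?_⟩⟩
  · obtain ⟨p, -, rfl, hp⟩ := hC.exists_mem_complement Set.sdiff_subset (max R R')
    exact (hcover p hp).imp (fun h => (connectedComponentIn_eq h).symm)
      fun h => (connectedComponentIn_eq h).symm
  · rintro (rfl | rfl)
    · exact ⟨⟨x, hcR hx, rfl⟩, fun r => (hdeep r).1⟩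
    · exact ⟨⟨y, hcR hy, rfl⟩, fun r => (hdeep r).2⟩

/-- One pair of separated points, far enough out for the scales `R₀` and `R₁` together, labels the
deep components at both; stability is then a comparison of labels. -/
theorem coarselySeparatesInto_two {X : MetricSimplicialComplex V}
    {K : PreAbstractSimplicialComplex V} (hK : K ≤ X.toPreAbstractSimplicialComplex) {R₀ : ℕ}
    (hA : ∀ R, ∃ R', ∀ x ∈ X.complement R' K, ∀ y ∈ X.complement R' K, ∀ z ∈ X.complement R' K,
      y ∈ connectedComponentIn (X.complement R K) x ∨
      z ∈ connectedComponentIn (X.complement R K) x ∨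
      z ∈ connectedComponentIn (X.complement R K) y)
    (hB : ∀ R', ∃ x ∈ X.complement R' K, ∃ y ∈ X.complement R' K,
      y ∉ connectedComponentIn (X.complement R₀ K) x) : X.CoarselySeparatesInto K 2 := by
  obtain ⟨R', hR', h⟩ := exists_forall_isDeepComponent_iff hK hA hB le_rfl
  refine ⟨R₀, ?_, fun C hC R₁ hR₁ => ?_⟩
  · obtain ⟨x, hx, y, hy, hxy⟩ := hB R'
    have h1 : {C | X.IsDeepComponent K (X.complement R₀ K) C} =
        {connectedComponentIn (X.complement R₀ K) x,
          connectedComponentIn (X.complement R₀ K) y} :=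
      Set.ext fun C => (h x hx y hy hxy).2 C
    rw [h1, Set.encard_pair]
    · rfl
    · intro heq
      rw [heq] at hxy
      exact hxy (mem_connectedComponentIn (complement_anti hK hR' hy))
  · obtain ⟨R₁', hR₁', h₁⟩ := exists_forall_isDeepComponent_iff hK hA hB hR₁
    have hpair : ∃ x ∈ X.complement (max R' R₁') K, ∃ y ∈ X.complement (max R' R₁') K,
        y ∉ connectedComponentIn (X.complement R₀ K) x ∧
        C = connectedComponentIn (X.complement R₀ K) x := by
      obtain ⟨x, hx, y, hy, hxy⟩ := hB (max R' R₁')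
      have hx' := complement_anti hK (le_max_left R' R₁') hx
      have hy' := complement_anti hK (le_max_left R' R₁') hy
      rcases ((h x hx' y hy' hxy).2 C).1 hC with hC | hC
      · exact ⟨x, hx, y, hy, hxy, hC⟩
      · exact ⟨y, hy, x, hx,
          not_mem_connectedComponentIn_symm (complement_anti hK hR' hy') hxy, hC⟩
    obtain ⟨x, hx, y, hy, hxy, rfl⟩ := hpair
    have hx₁ := complement_anti hK (le_max_right R' R₁') hx
    have hy₁ := complement_anti hK (le_max_right R' R₁') hy
    have hx₂ := complement_anti hK hR₁' hx₁
    refine ⟨connectedComponentIn (X.complement R₁ K) x,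
      ⟨((h₁ x hx₁ y hy₁ hxy).2 _).2 (Or.inl rfl), x,
        mem_connectedComponentIn (complement_anti hK hR₁ hx₂), mem_connectedComponentIn hx₂⟩, ?_⟩
    rintro C' ⟨hC', p, hpx, hpC'⟩
    rcases ((h₁ x hx₁ y hy₁ hxy).2 C').1 hC' with rfl | rfl
    · rfl
    -- If the component of `y` at scale `R₁` met that of `x` at scale `R₀`, then `x` and `y` would
    -- not be separated at scale `R₀`.
    · have h2 := connectedComponentIn_mono y (complement_anti hK hR₁) hpC'
      rw [connectedComponentIn_eq hpx, ← connectedComponentIn_eq h2] at hxy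
      exact (hxy (mem_connectedComponentIn
        (complement_anti hK (hR₁.trans hR₁') hy₁))).elim

/-! ### Coarse separation by the image of `g` -/

namespace JordanData

variable [LinearOrder V] [LinearOrder V'] {X : MetricSimplicialComplex V}
  {X' : MetricSimplicialComplex V'} {n : ℤ} {g : V' → V}

theorem exists_mem_connectedComponentIn_of_three (J : JordanData X X' n g)
    {K : PreAbstractSimplicialComplex V} (hK : K ≤ X.toPreAbstractSimplicialComplex)
    (hKg : vertexSet K = g '' Set.univ) (R : ℕ) :
    ∃ R', ∀ x ∈ X.complement R' K, ∀ y ∈ X.complement R' K, ∀ z ∈ X.complement R' K,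
      y ∈ connectedComponentIn (X.complement R K) x ∨
      z ∈ connectedComponentIn (X.complement R K) x ∨
      z ∈ connectedComponentIn (X.complement R K) y := by
  obtain ⟨r, hr⟩ := J.exists_joinedWithin_of_three (R + 1)
  rw [← hKg] at hr
  refine ⟨max r (R + 1), fun x hx y hy z hz => ?_⟩
  have h1 := complement_anti hK (le_max_left r (R + 1))
  have h2 := complement_anti hK (le_max_right r (R + 1))
  obtain ⟨u, hu⟩ := exists_ne_zero_of_mem_complement hx
  obtain ⟨v, hv⟩ := exists_ne_zero_of_mem_complement hy
  obtain ⟨w, hw⟩ := exists_ne_zero_of_mem_complement hz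
  refine (hr u (mem_farSet_of_mem_complement (h1 hx) hu) v
    (mem_farSet_of_mem_complement (h1 hy) hv) w
    (mem_farSet_of_mem_complement (h1 hz) hw)).imp ?_ (Or.imp ?_ ?_)
  · exact JoinedWithin.mem_connectedComponentIn (h2 hx) (h2 hy) hu hv
  · exact JoinedWithin.mem_connectedComponentIn (h2 hx) (h2 hz) hu hw
  · exact JoinedWithin.mem_connectedComponentIn (h2 hy) (h2 hz) hv hw

theorem exists_not_mem_connectedComponentIn (J : JordanData X X' n g)
    {K : PreAbstractSimplicialComplex V} (hKg : vertexSet K = g '' Set.univ) :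
    ∃ R, ∀ R', ∃ S, ∀ v, ∃ x y : V,
      (Pi.single x 1 : V → ℝ) ∈ X.complement R' K ∧ (Pi.single y 1 : V → ℝ) ∈ X.complement R' K ∧
      X.dist (g v) x ≤ S ∧ X.dist (g v) y ≤ S ∧
      (Pi.single y 1 : V → ℝ) ∉ connectedComponentIn (X.complement R K) (Pi.single x 1) := by
  obtain ⟨s, hs⟩ := J.exists_not_joinedWithin
  rw [← hKg] at hs
  refine ⟨s, fun R' => ?_⟩
  obtain ⟨S, hS⟩ := hs (R' + 1)
  refine ⟨S, fun v => ?_⟩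
  obtain ⟨x, hx, y, hy, hxS, hyS, hxy⟩ := hS v
  exact ⟨x, y, single_mem_complement hx, single_mem_complement hy, hxS, hyS, fun h =>
    hxy (joinedWithin_of_mem_connectedComponentIn h (by simp) (by simp))⟩

theorem not_coarselySeparates (J : JordanData X X' n g) {K : PreAbstractSimplicialComplex V}
    (hK : K ≤ X.toPreAbstractSimplicialComplex) {Z : Set V'} (hKg : vertexSet K = g '' Z)
    (hZ : ∀ t : ℕ, ∃ w, ∀ z ∈ Z, t ≤ X'.dist z w) : ¬ X.CoarselySeparates K := by
  rintro ⟨R, C₁, C₂, hne, hC₁, hC₂⟩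
  obtain ⟨r, hr⟩ := J.exists_joinedWithin_of_unbounded (R + 1) hZ
  rw [← hKg] at hr
  obtain ⟨x, -, rfl, hx⟩ := hC₁.exists_mem_complement Set.sdiff_subset (max r (R + 1))
  obtain ⟨y, -, rfl, hy⟩ := hC₂.exists_mem_complement Set.sdiff_subset (max r (R + 1))
  have h1 := complement_anti hK (le_max_left r (R + 1))
  have h2 := complement_anti hK (le_max_right r (R + 1))
  obtain ⟨u, hu⟩ := exists_ne_zero_of_mem_complement hx
  obtain ⟨v, hv⟩ := exists_ne_zero_of_mem_complement hy
  exact hne (connectedComponentIn_eq (JoinedWithin.mem_connectedComponentIn (h2 hx) (h2 hy) hu hv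
    (hr u (mem_farSet_of_mem_complement (h1 hx) hu) v
      (mem_farSet_of_mem_complement (h1 hy) hv))))

/-- A deep component of the closed complement contains a point `q` far from `K`. Near any `g v`
there are two separated far vertices, and `q` shares a component of the smaller complement at scale
`max R R₀` with one of them. That vertex therefore lies in the given component; `R` accounts for the
distance from `p` to some `g v`. -/
theorem exists_pointNear (J : JordanData X X' n g) {K : PreAbstractSimplicialComplex V}
    (hK : K ≤ X.toPreAbstractSimplicialComplex) (hKg : vertexSet K = g '' Set.univ) (R : ℕ) :
    ∃ S : ℕ, ∀ C : Set (V → ℝ), X.IsDeepComponent K (X.closedComplement R K) C →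
      ∀ p ∈ (X.nbhd R K).realization, X.PointNear S p C := by
  obtain ⟨R₀, hR₀⟩ := J.exists_not_mem_connectedComponentIn hKg
  obtain ⟨v₀⟩ := X'.connected.nonempty
  obtain ⟨R', hR', h⟩ := exists_forall_isDeepComponent_iff hK
    (J.exists_mem_connectedComponentIn_of_three hK hKg) (R₀ := R₀) (fun R' => by
      obtain ⟨S, hS⟩ := hR₀ R'
      obtain ⟨x, y, hx, hy, -, -, hxy⟩ := hS v₀
      exact ⟨_, hx, _, hy, hxy⟩) (le_max_right R R₀)
  obtain ⟨S, hS⟩ := hR₀ R'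
  refine ⟨R + S, fun C hC p hp => ?_⟩
  obtain ⟨q, hq, rfl, hqR'⟩ := hC.exists_mem_complement Set.inter_subset_right R'
  obtain ⟨σ, hσ, hσp, hcell⟩ := mem_cell_of_mem_realization hp
  obtain ⟨u, hu, hpu⟩ := exists_ne_zero_of_mem_cell hcell
  obtain ⟨k, hk, hku⟩ := X.exists_dist_le_of_mem_nbhd hσ hu
  obtain ⟨v, -, rfl⟩ : k ∈ g '' Set.univ := hKg ▸ hk
  obtain ⟨x, y, hx, hy, hxS, hyS, hxy⟩ := hS v
  have hsub : X.complement (max R R₀) K ⊆ X.closedComplement R K := fun p hp =>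
    ⟨subset_closure (complement_anti hK (le_max_left R R₀) hp), hp.1⟩
  have hnear : ∀ z, X.dist (g v) z ≤ S → (Pi.single z 1 : V → ℝ) ∈ X.complement R' K →
      q ∈ connectedComponentIn (X.complement (max R R₀) K) (Pi.single z 1) →
      X.PointNear (R + S) p (connectedComponentIn (X.closedComplement R K) q) := by
    intro z hz hzR' hqz
    refine ⟨Pi.single z 1, connectedComponentIn_mono q hsub ?_, u, z, hpu, by simp, ?_⟩
    · rw [← connectedComponentIn_eq hqz]
      exact mem_connectedComponentIn (complement_anti hK hR' hzR')
    · have h1 := X.dist_triangle u (g v) z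
      have h2 := X.dist_comm u (g v)
      omega
  rcases (h _ hx _ hy hxy).1 q hqR' with h1 | h1
  · exact hnear x hxS hx h1
  · exact hnear y hyS hy h1

end JordanData

end MetricSimplicialComplex

/-- Coarse Jordan separation.  The linear orders on the vertices serve only to orient the
simplices. -/
theorem mainTheorem9 {V V' : Type*} [LinearOrder V] [LinearOrder V'] (n : ℤ)
    (X : MetricSimplicialComplex V) (X' : MetricSimplicialComplex V')
    (hX : X.IsCoarsePD n) (hX' : X'.IsCoarsePD (n - 1)) (g : V' → V)
    (hg : MetricSimplicialComplex.IsSimplicialMap X' X g)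
    (hgp : MetricSimplicialComplex.IsUniformlyProper X' X g) :
    -- `g(X')` coarsely separates `X` into exactly two components
    X.CoarselySeparatesInto (X'.toPreAbstractSimplicialComplex.map g) 2 ∧
    -- for every `R`, the points of `N_R(g(X'))` are uniformly close to each of the deep components
    -- of the closure of `X - N_R(g(X'))`
    (∀ R : ℕ, ∃ S : ℕ, ∀ C : Set (V → ℝ),
      X.IsDeepComponent (X'.toPreAbstractSimplicialComplex.map g)
        (X.closedComplement R (X'.toPreAbstractSimplicialComplex.map g)) C →
      ∀ x ∈ (X.nbhd R (X'.toPreAbstractSimplicialComplex.map g)).realization,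
        X.PointNear S x C) ∧
    -- if no `N_R(Z)` contains `X'`, then `g(Z)` does not coarsely separate `X`
    (∀ Z : PreAbstractSimplicialComplex V', Z ≤ X'.toPreAbstractSimplicialComplex →
      (∀ R : ℕ, ¬ X'.toPreAbstractSimplicialComplex ≤ X'.nbhd R Z) →
      ¬ X.CoarselySeparates (Z.map g)) := by
  obtain ⟨J⟩ := hX.exists_jordanData hX' hg hgp
  have hmap : ∀ Z : PreAbstractSimplicialComplex V', Z ≤ X'.toPreAbstractSimplicialComplex →
      Z.map g ≤ X.toPreAbstractSimplicialComplex := by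
    rintro Z hZ _ ⟨σ, hσ, rfl⟩
    exact hg σ (hZ hσ)
  have hK := hmap _ le_rfl
  have hKg : MetricSimplicialComplex.vertexSet (X'.toPreAbstractSimplicialComplex.map g) =
      g '' Set.univ := by
    rw [MetricSimplicialComplex.vertexSet_map,
      MetricSimplicialComplex.vertexSet_toPreAbstractSimplicialComplex]
  refine ⟨?_, J.exists_pointNear hK hKg, fun Z hZ hZu => ?_⟩
  · obtain ⟨R₀, hR₀⟩ := J.exists_not_mem_connectedComponentIn hKg
    obtain ⟨v₀⟩ := X'.connected.nonempty
    refine MetricSimplicialComplex.coarselySeparatesInto_two hK (R₀ := R₀)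
      (J.exists_mem_connectedComponentIn_of_three hK hKg) fun R' => ?_
    obtain ⟨S, hS⟩ := hR₀ R'
    obtain ⟨x, y, hx, hy, -, -, hxy⟩ := hS v₀
    exact ⟨_, hx, _, hy, hxy⟩
  · refine J.not_coarselySeparates (hmap Z hZ) (MetricSimplicialComplex.vertexSet_map Z g)
      fun t => ?_
    -- Every vertex of a simplex outside `N_t(Z)` has distance at least `t` from `Z`.
    obtain ⟨σ, hσ, hσt⟩ := Set.not_subset.1 (hZu t)
    obtain ⟨w, hw⟩ := MetricSimplicialComplex.nonempty_of_mem hσ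
    refine ⟨w, fun z hz => ?_⟩
    by_contra hlt
    exact hσt (X'.mem_nbhd_of_dist_lt hσ hw hz (not_le.1 hlt))
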